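/- **Setting.** Let $\mathbb C[u,u^{-1};\mathbf v]$ be the algebra of Laurent polynomials in $u$ with coefficients in the polynomial ring $\mathbb C[\mathbf v]$ in commuting variables $v_{\pm1},v_{\pm2},\dots$. Let $\mathcal D=-\mathcal N-2\mathcal Z-2\mathcal Y$ on this algebra, where $\mathcal N$ multiplies each monomial $u^{n}\prod_k v_k^{m_k}$ by its trace degree $|n|+\sum_k|k|m_k$, where $$\mathcal Z=\sum_{k\ge2}\Big(\sum_{j=1}^{k-1}j\,v_jv_{k-j}\Big)\frac{\partial}{\partial v_k}-\sum_{k\le-2}\Big(\sum_{j=k+1}^{-1}j\,v_jv_{k-j}\Big)\frac{\partial}{\partial v_k},$$ and where $\mathcal Y$ is $\mathbb C[\mathbf v]$-linear with $\mathcal Y(u^n)=\sum_{k=1}^{n-1}(n-k)v_ku^{n-k}$ for $n\ge0$ and $\mathcal Y(u^n)=-\sum_{k=n+1}^{-1}(n-k)v_ku^{n-k}$ for $n<0$. The operator $\mathcal D$ leaves invariant each of the finite-dimensional spaces of elements of trace degree at most $n$, so that $e^{\tau\mathcal D}$ is well defined for $\tau\in\mathbb R$. Put $\nu_0(s)=1$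 and, for $k\ne0$, $$\nu_k(s)=e^{-\frac{|k|}{2}s}\sum_{j=0}^{|k|-1}\frac{(-s)^j}{j!}|k|^{j-1}\binom{|k|}{j+1},$$ and let $\pi_s\colon\mathbb C[u,u^{-1};\mathbf v]\to\mathbb C[u,u^{-1}]$ be the evaluation $v_k\mapsto\nu_k(s)$. The free unitary Segal–Bargmann transform and its inverse are the operators $\mathscr G_{s,t}=\pi_{s-t}\circ e^{\frac t2\mathcal D}$ and $\mathscr H_{s,t}=\pi_s\circ e^{-\frac t2\mathcal D}$ on $\mathbb C[u,u^{-1}]$. For $t>0$, let $\nu_t$ be the law of the free unitary Brownian motion, that is, the probability measure on the unit circle $\mathbb U$ with $\int\omega^k\,\nu_t(d\omega)=\nu_k(t)$ for all $k\in\mathbb Z$. Let $\chi_t$ be the continuous function on the closed unit disc $\overline{\mathbb D}$, holomorphic inside and avoiding the value $1$, with $\chi_t(0)=0$ and $\chi_t(\zeta)\exp\big(\tfrac t2\tfrac{1+\chi_t(\zeta)}{1-\chi_t(\zeta)}\big)=\zeta$ for $|\zeta|\le1$. Let $\Sigma_t$ be the set of $z\ne0$ such that neither $z$ nor $1/\bar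 z$ lies in $\chi_t(\overline{\mathbb D})$. Biane's free Hall transform is $$(\mathscr G^tf)(z)=\int_{\mathbb U}f(\omega)\,\frac{|1-\chi_t(\omega)|^2}{(z-\chi_t(\omega))(z^{-1}-\overline{\chi_t(\omega)})}\,\nu_t(d\omega),\qquad z\in\Sigma_t.$$ **Theorem.** Let $s,t>0$ with $s>t/2$, and for $k\ge1$ let $p_k^{s,t}=\mathscr H_{s,t}(u^k)$. 1. Each $p_k^{s,t}$, $k\ge 1$, is a polynomial in $u$, and the power series $\Pi(s,t,u,z)=\sum_{k\ge1}p^{s,t}_k(u)z^k$ converges for all sufficiently small $u,z\in\mathbb C$. 2. For all sufficiently small $u,z\in\mathbb C$, $$\Pi\big(s,t,u,ze^{\frac12(s-t)\frac{1+z}{1-z}}\big)=\big(1-uze^{\frac s2\frac{1+z}{1-z}}\big)^{-1}-1,$$ and this formula determines $\Pi$ near the origin: every function $F(u,z)$ that satisfies it in place of $\Pi(s,t,\cdot,\cdot)$ for all sufficiently small $u,z$ equals $\Pi(s,t,u,z)$ for all sufficiently small $u,z$. 3. If $s=t$, then $\mathscr G_{t,t}$ is Biane's free Hall transform: the measure $\nu_t$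 and the map $\chi_t$ exist, and for every Laurent polynomial $f$ and every $z\in\Sigma_t$ one has $(\mathscr G^tf)(z)=(\mathscr G_{t,t}f)(z)$ and $(\mathscr G^t\mathscr H_{t,t}f)(z)=f(z)$. -/

import Mathlib

open Filter Topology MeasureTheory
open scoped LaurentPolynomial

noncomputable section

namespace FreeSB

/-! ### Trace polynomials -/

/-- The index set `{±1, ±2, …}` of the variables `v_k`. -/
abbrev TraceIdx : Type := {k : ℤ // k ≠ 0}

/-- The algebra `ℂ[v]` of complex polynomials in the commuting variables `v_{±1}, v_{±2}, …`. -/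
abbrev VPoly : Type := MvPolynomial TraceIdx ℂ

/-- The algebra `ℂ[u, u⁻¹; v]`: Laurent polynomials in `u` with coefficients in `ℂ[v]`. -/
abbrev TracePoly : Type := VPoly[T;T⁻¹]

/-- The variable `v_k`, with the convention `v_0 = 1`. -/
def v (k : ℤ) : VPoly := if h : k ≠ 0 then MvPolynomial.X ⟨k, h⟩ else 1

/-- The `ℂ`-linear operator on `ℂ[u, u⁻¹; v]` which sends `u ^ n * q(v)` to `F n q`. -/
def onMonomials (F : ℤ → VPoly →ₗ[ℂ] TracePoly) : TracePoly →ₗ[ℂ] TracePoly :=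
  Finsupp.lsum ℂ F ∘ₗ (AddMonoidAlgebra.coeffLinearEquiv ℂ).toLinearMap

/-- A linear operator of `ℂ[v]` acting on the coefficients of the powers of `u`. -/
def onCoeffs (A : VPoly →ₗ[ℂ] VPoly) : TracePoly →ₗ[ℂ] TracePoly :=
  onMonomials fun n => (AddMonoidAlgebra.lsingle n : VPoly →ₗ[ℂ] TracePoly) ∘ₗ A

/-- `𝒩₀ = ∑_{|k| ≥ 1} |k| v_k ∂/∂v_k`. -/
def opN0 : TracePoly →ₗ[ℂ] TracePoly :=
  onCoeffs (MvPolynomial.mkDerivation ℂ fun k : TraceIdx => ((|k.1| : ℤ) : ℂ) • v k.1).toLinearMap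

/-- `𝒩₁ = u ∂/∂u (𝒜₊ - 𝒜₋)`, that is `u ^ n * q(v) ↦ |n| u ^ n * q(v)`. -/
def opN1 : TracePoly →ₗ[ℂ] TracePoly :=
  onMonomials fun n => ((|n| : ℤ) : ℂ) • (AddMonoidAlgebra.lsingle n : VPoly →ₗ[ℂ] TracePoly)

/-- The coefficient of `∂/∂v_k` in the operator `𝒵`:
`∑_{j=1}^{k-1} j v_j v_{k-j}` for `k ≥ 2`, `-∑_{j=k+1}^{-1} j v_j v_{k-j}` for `k ≤ -2`, and
`0` (empty sums) for `k = ±1`. -/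
def zCoeff (k : ℤ) : VPoly :=
  if 0 < k then ∑ j ∈ Finset.Icc 1 (k - 1), (j : ℂ) • (v j * v (k - j))
  else -∑ j ∈ Finset.Icc (k + 1) (-1), (j : ℂ) • (v j * v (k - j))

/-- `𝒵 = ∑_{k ≥ 2} (∑_{j=1}^{k-1} j v_j v_{k-j}) ∂/∂v_k
  - ∑_{k ≤ -2} (∑_{j=k+1}^{-1} j v_j v_{k-j}) ∂/∂v_k`. -/
def opZ : TracePoly →ₗ[ℂ] TracePoly :=
  onCoeffs (MvPolynomial.mkDerivation ℂ fun k : TraceIdx => zCoeff k.1).toLinearMap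

/-- The Laurent polynomial `𝒴(u ^ n)`:
`∑_{k=1}^{n-1} (n-k) v_k u^{n-k}` for `n ≥ 0` and
`-∑_{k=n+1}^{-1} (n-k) v_k u^{n-k}` for `n < 0`. -/
def yPow (n : ℤ) : TracePoly :=
  if 0 ≤ n then
    ∑ k ∈ Finset.Icc 1 (n - 1), (AddMonoidAlgebra.single (n - k) (((n - k : ℤ) : ℂ) • v k))
  else -∑ k ∈ Finset.Icc (n + 1) (-1), (AddMonoidAlgebra.single (n - k) (((n - k : ℤ) : ℂ) • v k))

/-- The operator
`𝒴 = ∑_{k ≥ 1} v_k u 𝒜₊ ∂/∂u u^{-k} 𝒜₊ - ∑_{k ≤ -1} v_k u 𝒜₋ ∂/∂u u^{-k} 𝒜₋`,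
where `𝒜₊` and `𝒜₋` are the projections onto the nonnegative and onto the negative powers of `u`;
it is `ℂ[v]`-linear and is given by its action `yPow` on the powers of `u`. -/
def opY : TracePoly →ₗ[ℂ] TracePoly :=
  onMonomials fun n =>
    LinearMap.mulRight ℂ (yPow n) ∘ₗ (AddMonoidAlgebra.lsingle 0 : VPoly →ₗ[ℂ] TracePoly)

/-- The pseudodifferential operator `𝒟 = -𝒩 - 2𝒵 - 2𝒴` on `ℂ[u, u⁻¹; v]`, `𝒩 = 𝒩₀ + 𝒩₁`. -/
def opD : TracePoly →ₗ[ℂ] TracePoly :=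
  -(opN0 + opN1) - (2 : ℂ) • opZ - (2 : ℂ) • opY

/-! ### Exponentials of operators and the transforms -/

/-- `w = e^A x = ∑ₙ Aⁿ x / n!`, the series being understood weakly, against all linear functionals.
If `x` lies in a finite-dimensional subspace that is invariant under `A` (as every trace polynomial
does for the operator `𝒟`), there is exactly one such `w`, the value at `x` of the usual
exponential of the restriction of `A` to such a subspace. -/
def IsExpApply {V : Type*} [AddCommGroup V] [Module ℂ V] (A : V →ₗ[ℂ] V) (x w : V) : Prop :=
  ∀ φ : V →ₗ[ℂ] ℂ, HasSum (fun n : ℕ => ((n.factorial : ℂ))⁻¹ * φ ((A ^ n) x)) (φ w)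

/-- The value `e^A x` of the exponential of an operator. -/
def expApply {V : Type*} [AddCommGroup V] [Module ℂ V] (A : V →ₗ[ℂ] V) (x : V) : V :=
  Classical.epsilon (IsExpApply A x)

/-- `ν_0(s) = 1`, and for `k ≠ 0`
`ν_k(s) = e^{-|k|s/2} ∑_{j=0}^{|k|-1} ((-s)^j / j!) |k|^{j-1} binom(|k|, j+1)`. -/
def nu (k : ℤ) (s : ℝ) : ℝ :=
  if k = 0 then 1
  else Real.exp (-((k.natAbs : ℝ) / 2 * s)) *
    ∑ j ∈ Finset.range k.natAbs,
      (-s) ^ j / (j.factorial : ℝ) * (k.natAbs : ℝ) ^ ((j : ℤ) - 1) *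
        (k.natAbs.choose (j + 1) : ℝ)

/-- The trace evaluation map `π_s : ℂ[u, u⁻¹; v] → ℂ[u, u⁻¹]`, `v_k ↦ ν_k(s)`. -/
def traceEval (s : ℝ) : TracePoly →+* ℂ[T;T⁻¹] :=
  AddMonoidAlgebra.mapRingHom ℤ
    (MvPolynomial.aeval (R := ℂ) fun k : TraceIdx => ((nu k.1 s : ℝ) : ℂ)).toRingHom

/-- The inclusion `ℂ[u, u⁻¹] ⊆ ℂ[u, u⁻¹; v]`. -/
def incl : ℂ[T;T⁻¹] →+* TracePoly :=
  AddMonoidAlgebra.mapRingHom ℤ (MvPolynomial.C : ℂ →+* VPoly)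

/-- The free unitary Segal–Bargmann transform `𝒢_{s,t} = π_{s-t} ∘ e^{(t/2)𝒟}`. -/
def transformG (s t : ℝ) (f : ℂ[T;T⁻¹]) : ℂ[T;T⁻¹] :=
  traceEval (s - t) (expApply (((t / 2 : ℝ) : ℂ) • opD) (incl f))

/-- The free unitary inverse Segal–Bargmann transform `ℋ_{s,t} = π_s ∘ e^{-(t/2)𝒟}`. -/
def transformH (s t : ℝ) (f : ℂ[T;T⁻¹]) : ℂ[T;T⁻¹] :=
  traceEval s (expApply (((-(t / 2) : ℝ) : ℂ) • opD) (incl f))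

/-- The value of a Laurent polynomial at a point `z`; only used at `z ≠ 0`, or for elements of
`ℂ[u]`, for which it is the value of the polynomial also at `z = 0`. -/
def evalAt (f : ℂ[T;T⁻¹]) (z : ℂ) : ℂ := f.coeff.sum fun k a => a * z ^ k

/-! ### The generating function -/

/-- The `k`-th term (`k ≥ 1`) `p_k(u) z ^ k` of the generating function, `p_k = ℋ_{s,t}(u ^ k)`. -/
def genTerm (s t : ℝ) (u z : ℂ) (k : ℕ) : ℂ :=
  evalAt (transformH s t (LaurentPolynomial.T (k : ℤ))) u * z ^ k

/-- `Π(s,t,u,z) = ∑_{k ≥ 1} p_k(u) z ^ k`. -/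
def genFun (s t : ℝ) (u z : ℂ) : ℂ := ∑' k : ℕ, genTerm s t u z (k + 1)

/-- `exp ((a / 2) (1 + z) / (1 - z))`. -/
def expCayley (a : ℝ) (z : ℂ) : ℂ := Complex.exp ((a : ℂ) / 2 * ((1 + z) / (1 - z)))

/-! ### Biane's free Hall transform -/

/-- `χ` is the inverse of `w ↦ w exp ((t / 2) (1 + w) / (1 - w))` on the closed unit disc: it is
continuous there, holomorphic inside, and `χ 0 = 0`. These conditions determine `χ` on the closed
disc. -/
structure IsInverseMap (t : ℝ) (χ : ℂ → ℂ) : Prop where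
  continuousOn : ContinuousOn χ (Metric.closedBall 0 1)
  differentiableOn : DifferentiableOn ℂ χ (Metric.ball 0 1)
  map_zero : χ 0 = 0
  ne_one : ∀ ζ ∈ Metric.closedBall (0 : ℂ) 1, χ ζ ≠ 1
  right_inv : ∀ ζ ∈ Metric.closedBall (0 : ℂ) 1, χ ζ * expCayley t (χ ζ) = ζ

/-- The map `χ_t`. -/
def chi (t : ℝ) : ℂ → ℂ := Classical.epsilon (IsInverseMap t)

/-- `μ` is the law of the free unitary Brownian motion at time `t`: the probability measure on the
unit circle whose moments are the numbers `ν_k(t)`. -/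
structure IsFreeUnitaryLaw (t : ℝ) (μ : Measure ℂ) : Prop where
  prob : IsProbabilityMeasure μ
  circle : μ (Metric.sphere 0 1)ᶜ = 0
  moments : ∀ k : ℤ, ∫ ω, ω ^ k ∂μ = ((nu k t : ℝ) : ℂ)

/-- The measure `ν_t`. -/
def freeUnitaryLaw (t : ℝ) : Measure ℂ := Classical.epsilon (IsFreeUnitaryLaw t)

/-- The domain `Σ_t` of the functions in the range of the free Hall transform: the points `z ≠ 0`
such that neither `z` nor its reflection `1 / conj z` in the unit circle lies in the image of the
closed unit disc under `χ_t`. -/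
def domainSigma (t : ℝ) : Set ℂ :=
  {z | z ≠ 0 ∧ z ∉ chi t '' Metric.closedBall 0 1 ∧
    (starRingEnd ℂ z)⁻¹ ∉ chi t '' Metric.closedBall 0 1}

/-- Biane's free Hall transform of a function `f` on the unit circle,
`𝒢^t f (z) = ∫ f(ω) |1 - χ_t(ω)|² / ((z - χ_t(ω)) (z⁻¹ - conj χ_t(ω))) ν_t(dω)`, `z ∈ Σ_t`. -/
def freeHall (t : ℝ) (f : ℂ → ℂ) (z : ℂ) : ℂ :=
  ∫ ω, f ω * (((‖1 - chi t ω‖ ^ 2 : ℝ) : ℂ) /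
    ((z - chi t ω) * (z⁻¹ - starRingEnd ℂ (chi t ω)))) ∂(freeUnitaryLaw t)

end FreeSB

end

noncomputable section

namespace FreeSB

/-! ### Taylor coefficients at the origin -/

/-! Write `f_σ` for `coreMap σ`, `χ_σ` for its local inverse `coreInv σ`, and `η = w/(1-w)`. For a
germ `H` at `0` put `b_n(σ) = [z^n] H(χ_σ(z))` and `a_n(σ) = [z^n] η(χ_σ(z))`. Lagrange inversion
makes these explicit in `σ`. It gives `a_{|k|}(s) = ν_k(s)` (`invCoeff_eta_eq_nu`) and the
triangular system `b_n' = -(n/2) b_n - ∑_{i<n} a_i (n-i) b_{n-i}` (`hasDerivAt_invCoeff`).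

Along `σ + 2τ` this system is the dual form of `𝒟`: the functional `flow`, `u^n q(v) ↦ b_n(σ)
q(a(σ))` (with a second germ and `|n|` for `n < 0`), satisfies `d/dτ flow_{σ+2τ}(x) = flow_{σ+2τ}(𝒟
x)`. Hence `flow_σ(e^{c𝒟} x) = flow_{σ+2c}(x)` (`flow_expApply`), and the exponential never has to
be computed.

For `H = u f_s/(1 - u f_s)` one has `H(χ_s(z)) = uz/(1-uz)`, so `b_n(s) = u^n` and `flow_s` is `π_s`
followed by evaluation at `u`. Therefore `p_k(u) = [z^k] H(χ_{s-t}(z))`, and `Π` is `H ∘ χ_{s-t}`.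
Substituting `f_{s-t}(z)` for `z` gives the implicit formula; since `f_{s-t}` is onto a
neighbourhood of `0`, the formula determines `Π`.

For `s = t` the same argument with `f_0 = id` shows that `𝒢_{t,t}(u^k)(z)` is `[ζ^k]` of
`zχ_t/(1-zχ_t)` for `k > 0`, with `z⁻¹` and `|k|` for `k < 0`. On the analytic side `ν_t` has
density `Re((1+χ_t)/(1-χ_t))`. Times Biane's kernel it becomes `A + conj B` with `A`, `B`
holomorphic in the disc (`density_mul_kernel`), whose Fourier coefficients are these same numbers.
The map `χ_t` is built by fixed point iteration in the open disc and extended to the circle because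
its cluster sets there are connected subsets of finite fibres. -/

/-- The `n`-th Taylor coefficient of `f` at `0`. -/
def taylorCoeff (f : ℂ → ℂ) (n : ℕ) : ℂ := iteratedDeriv n f 0 / (n.factorial : ℂ)

lemma factorial_ne_zero' (n : ℕ) : (n.factorial : ℂ) ≠ 0 := by
  exact_mod_cast n.factorial_ne_zero

lemma taylorCoeff_zero (f : ℂ → ℂ) : taylorCoeff f 0 = f 0 := by simp [taylorCoeff]

lemma taylorCoeff_congr {f g : ℂ → ℂ} (h : f =ᶠ[𝓝 0] g) (n : ℕ) :
    taylorCoeff f n = taylorCoeff g n := by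
  rw [taylorCoeff, taylorCoeff, h.iteratedDeriv_eq]

lemma taylorCoeff_add {f g : ℂ → ℂ} (hf : AnalyticAt ℂ f 0) (hg : AnalyticAt ℂ g 0) (n : ℕ) :
    taylorCoeff (fun z => f z + g z) n = taylorCoeff f n + taylorCoeff g n := by
  simp only [taylorCoeff]
  rw [iteratedDeriv_fun_add hf.contDiffAt hg.contDiffAt, add_div]

lemma taylorCoeff_sub {f g : ℂ → ℂ} (hf : AnalyticAt ℂ f 0) (hg : AnalyticAt ℂ g 0) (n : ℕ) :
    taylorCoeff (fun z => f z - g z) n = taylorCoeff f n - taylorCoeff g n := by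
  simp only [taylorCoeff]
  rw [iteratedDeriv_fun_sub hf.contDiffAt hg.contDiffAt, sub_div]

lemma taylorCoeff_const_mul (c : ℂ) (f : ℂ → ℂ) (n : ℕ) :
    taylorCoeff (fun z => c * f z) n = c * taylorCoeff f n := by
  simp only [taylorCoeff]
  rw [iteratedDeriv_const_mul_field, mul_div_assoc]

lemma taylorCoeff_sum {ι : Type*} (s : Finset ι) {f : ι → ℂ → ℂ}
    (hf : ∀ i ∈ s, AnalyticAt ℂ (f i) 0) (n : ℕ) :
    taylorCoeff (fun z => ∑ i ∈ s, f i z) n = ∑ i ∈ s, taylorCoeff (f i) n := by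
  simp only [taylorCoeff]
  rw [iteratedDeriv_fun_sum (fun i hi => (hf i hi).contDiffAt), Finset.sum_div]

lemma taylorCoeff_mul {f g : ℂ → ℂ} (hf : AnalyticAt ℂ f 0) (hg : AnalyticAt ℂ g 0) (n : ℕ) :
    taylorCoeff (fun z => f z * g z) n =
      ∑ i ∈ Finset.range (n + 1), taylorCoeff f i * taylorCoeff g (n - i) := by
  simp only [taylorCoeff]
  rw [iteratedDeriv_fun_mul hf.contDiffAt hg.contDiffAt, Finset.sum_div]
  refine Finset.sum_congr rfl fun i hi => ?_
  have hi : i ≤ n := by simpa [Nat.lt_succ_iff] using hi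
  have := factorial_ne_zero' n
  have := factorial_ne_zero' i
  have := factorial_ne_zero' (n - i)
  have h : (n.choose i : ℂ) * (i.factorial : ℂ) * ((n - i).factorial : ℂ) = n.factorial := by
    exact_mod_cast Nat.choose_mul_factorial_mul_factorial hi
  field_simp
  rw [← h]; ring

lemma taylorCoeff_pow (m n : ℕ) :
    taylorCoeff (fun z => z ^ m) n = if n = m then 1 else 0 := by
  rw [taylorCoeff, iteratedDeriv_fun_pow_zero]
  split_ifs with h
  · rw [h, div_self (factorial_ne_zero' m)]
  · simp

lemma taylorCoeff_pow_mul {f : ℂ → ℂ} (hf : AnalyticAt ℂ f 0) (m n : ℕ) :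
    taylorCoeff (fun z => z ^ m * f z) n = if m ≤ n then taylorCoeff f (n - m) else 0 := by
  rw [taylorCoeff_mul (by fun_prop) hf]
  simp only [taylorCoeff_pow, ite_mul, one_mul, zero_mul, Finset.sum_ite_eq', Finset.mem_range,
    Nat.lt_succ_iff]

lemma taylorCoeff_const (c : ℂ) (n : ℕ) :
    taylorCoeff (fun _ => c) n = if n = 0 then c else 0 := by
  have := taylorCoeff_const_mul c (fun z => z ^ 0) n
  rw [taylorCoeff_pow] at this
  simpa using this

lemma taylorCoeff_deriv (f : ℂ → ℂ) (n : ℕ) :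
    taylorCoeff (deriv f) n = (n + 1) * taylorCoeff f (n + 1) := by
  simp only [taylorCoeff]
  rw [iteratedDeriv_succ', Nat.factorial_succ]
  have := factorial_ne_zero' n
  have : (n : ℂ) + 1 ≠ 0 := Nat.cast_add_one_ne_zero n
  push_cast
  field_simp

lemma exists_eq_taylor_add_pow_mul {f : ℂ → ℂ} (hf : AnalyticAt ℂ f 0) (n : ℕ) :
    ∃ R : ℂ → ℂ, AnalyticAt ℂ R 0 ∧
      ∀ z, f z = ∑ i ∈ Finset.range n, taylorCoeff f i * z ^ i + z ^ n * R z := by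
  obtain ⟨R, hR, h⟩ := hf.exists_eq_sum_add_pow_mul n
  refine ⟨R, hR, fun z => (h z).trans ?_⟩
  congr 1
  refine Finset.sum_congr rfl fun i _ => ?_
  rw [taylorCoeff, smul_eq_mul]; ring

/-- Taylor coefficients of a function that is a multiple of a power `f ^ m` with `f 0 = 0`. -/
lemma taylorCoeff_pow_mul_of_lt {f R : ℂ → ℂ} (hf : AnalyticAt ℂ f 0) (h0 : f 0 = 0)
    (hR : AnalyticAt ℂ R 0) {m n : ℕ} (hn : n < m) :
    taylorCoeff (fun z => f z ^ m * R z) n = 0 := by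
  obtain ⟨S, hS, h⟩ := exists_eq_taylor_add_pow_mul hf 1
  have h' : (fun z => f z ^ m * R z) = fun z => z ^ m * (S z ^ m * R z) := by
    ext z
    rw [h z]
    simp [taylorCoeff_zero, h0, mul_pow, mul_assoc]
  rw [h', taylorCoeff_pow_mul (by fun_prop), if_neg (by omega)]

/-- A composition `P ∘ f` with `f 0 = 0` is expanded in powers of `f`. -/
lemma taylorCoeff_comp_mul {P f Q : ℂ → ℂ} (hP : AnalyticAt ℂ P 0) (hf : AnalyticAt ℂ f 0)
    (h0 : f 0 = 0) (hQ : AnalyticAt ℂ Q 0) {n N : ℕ} (hn : n < N) :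
    taylorCoeff (fun z => P (f z) * Q z) n =
      ∑ i ∈ Finset.range N, taylorCoeff P i * taylorCoeff (fun z => f z ^ i * Q z) n := by
  obtain ⟨R, hR, h⟩ := exists_eq_taylor_add_pow_mul hP N
  have hRf : AnalyticAt ℂ (fun z => R (f z)) 0 := by
    apply AnalyticAt.fun_comp _ hf
    rwa [h0]
  have h' : (fun z => P (f z) * Q z) = fun z =>
      ∑ i ∈ Finset.range N, taylorCoeff P i * (f z ^ i * Q z) + f z ^ N * (R (f z) * Q z) := by
    ext z
    rw [h (f z), add_mul, Finset.sum_mul]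
    simp only [mul_assoc]
  have hRQ := hRf.fun_mul hQ
  rw [h', taylorCoeff_add (Finset.analyticAt_fun_sum _ fun i _ => by fun_prop)
      ((hf.fun_pow N).fun_mul hRQ), taylorCoeff_sum _ (fun i _ => by fun_prop),
    taylorCoeff_pow_mul_of_lt hf h0 hRQ hn, add_zero]
  exact Finset.sum_congr rfl fun i _ => taylorCoeff_const_mul _ _ _

lemma hasSum_taylorCoeff {f : ℂ → ℂ} {r : ℝ} (hf : DifferentiableOn ℂ f (Metric.ball 0 r))
    {z : ℂ} (hz : z ∈ Metric.ball 0 r) : HasSum (fun n => taylorCoeff f n * z ^ n) (f z) := by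
  have hr : 0 < r := Metric.nonempty_ball.1 ⟨z, hz⟩
  have := Complex.hasSum_taylorSeries_on_ball hf hz
  refine this.congr_fun ?_
  intro n
  simp [taylorCoeff, div_eq_inv_mul]; ring

/-! ### Lagrange inversion -/

/-- Residue computation behind Lagrange inversion: if `f φ = w` then the `n`-th coefficient of
`f ^ i f' φ ^ (n + 1)` is `1` for `i = n` and `0` for `i < n`. -/
lemma taylorCoeff_pow_mul_deriv_mul_pow {f φ : ℂ → ℂ} (hf : AnalyticAt ℂ f 0) (h0 : f 0 = 0)
    (hφ : AnalyticAt ℂ φ 0) (h : ∀ᶠ w in 𝓝 (0 : ℂ), f w * φ w = w) {i n : ℕ} (hi : i ≤ n) :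
    taylorCoeff (fun w => f w ^ i * (deriv f w * φ w ^ (n + 1))) n = if i = n then 1 else 0 := by
  have hd : ∀ᶠ w in 𝓝 (0 : ℂ), deriv f w * φ w = 1 - f w * deriv φ w := by
    have h1 : ∀ᶠ w in 𝓝 (0 : ℂ), deriv (fun w => f w * φ w) w = deriv (fun w => w) w :=
      EventuallyEq.deriv h
    filter_upwards [h1, hf.eventually_analyticAt, hφ.eventually_analyticAt] with w h1 h2 h3
    rw [deriv_fun_mul h2.differentiableAt h3.differentiableAt, deriv_id''] at h1
    linear_combination h1
  obtain ⟨m, rfl⟩ := Nat.exists_eq_add_of_le hi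
  -- The relation `f φ = w` turns `f ^ i φ ^ i` into `w ^ i`, so only the coefficient of index `m =
  -- n - i` of the remaining factor matters.
  have e1 : (fun w => f w ^ i * (deriv f w * φ w ^ (i + m + 1))) =ᶠ[𝓝 0]
      fun w => w ^ i * ((1 - f w * deriv φ w) * φ w ^ m) := by
    filter_upwards [h, hd] with w h1 h2
    rw [← h2, ← h1, mul_pow, h1]; ring
  have hdf : AnalyticAt ℂ (deriv f) 0 := hf.deriv
  have hdφ : AnalyticAt ℂ (deriv φ) 0 := hφ.deriv
  rw [taylorCoeff_congr e1, taylorCoeff_pow_mul (by fun_prop), if_pos (by omega)]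
  rcases m with _ | m
  · simp [taylorCoeff_zero, h0]
  rw [if_neg (by omega), Nat.add_sub_cancel_left]
  -- The operator `1 - (m+1)⁻¹ w d/dw` kills the coefficient of index `m + 1`; this is the vanishing
  -- of the residue of a derivative.
  have e2 : (fun w => (1 - f w * deriv φ w) * φ w ^ (m + 1)) =ᶠ[𝓝 0]
      fun w => φ w ^ (m + 1) - ((m : ℂ) + 1)⁻¹ * (w ^ 1 * deriv (fun w => φ w ^ (m + 1)) w) := by
    filter_upwards [h, hφ.eventually_analyticAt] with w h1 h3
    rw [deriv_fun_pow h3.differentiableAt]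
    have : (m : ℂ) + 1 ≠ 0 := Nat.cast_add_one_ne_zero m
    simp only [Nat.add_sub_cancel]
    push_cast
    field_simp
    linear_combination (-(φ w ^ m * deriv φ w)) * h1
  have hdp : AnalyticAt ℂ (deriv (fun w => φ w ^ (m + 1))) 0 := (hφ.pow (m + 1)).deriv
  rw [taylorCoeff_congr e2, taylorCoeff_sub (by fun_prop) (by fun_prop), taylorCoeff_const_mul,
    taylorCoeff_pow_mul hdp, if_pos (by omega), Nat.add_sub_cancel, taylorCoeff_deriv]
  have : (m : ℂ) + 1 ≠ 0 := Nat.cast_add_one_ne_zero m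
  field_simp
  ring

/-- **Lagrange inversion**: if `g` is the inverse of `f = w / φ(w)` near the origin, then the
`n`-th Taylor coefficient of `(L ∘ g) g'` is that of `L φ ^ (n + 1)`. -/
lemma taylorCoeff_comp_mul_deriv {f g φ L : ℂ → ℂ} (hf : AnalyticAt ℂ f 0) (h0 : f 0 = 0)
    (hφ : AnalyticAt ℂ φ 0) (h : ∀ᶠ w in 𝓝 (0 : ℂ), f w * φ w = w) (hg : AnalyticAt ℂ g 0)
    (hg0 : g 0 = 0) (hgf : ∀ᶠ w in 𝓝 (0 : ℂ), g (f w) = w) (hL : AnalyticAt ℂ L 0) (n : ℕ) :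
    taylorCoeff (fun z => L (g z) * deriv g z) n = taylorCoeff (fun w => L w * φ w ^ (n + 1)) n := by
  have hdf : AnalyticAt ℂ (deriv f) 0 := hf.deriv
  have hdg : AnalyticAt ℂ (deriv g) 0 := hg.deriv
  have hLg : AnalyticAt ℂ (fun z => L (g z)) 0 := by
    apply AnalyticAt.fun_comp _ hg
    rwa [hg0]
  have hP : AnalyticAt ℂ (fun z => L (g z) * deriv g z) 0 := hLg.fun_mul hdg
  have hfc : Tendsto f (𝓝 0) (𝓝 0) := by
    have := hf.continuousAt.tendsto
    rwa [h0] at this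
  -- Change of variables `z = f w`: the factor `1 = g'(f w) f'(w)` is inserted, and `(L ∘ g) g'` is
  -- then expanded in powers of `f`, of which only the `n`-th contributes.
  have e : (fun w => L w * φ w ^ (n + 1)) =ᶠ[𝓝 0]
      fun w => (L (g (f w)) * deriv g (f w)) * (deriv f w * φ w ^ (n + 1)) := by
    have h1 : ∀ᶠ w in 𝓝 (0 : ℂ), deriv (fun w => g (f w)) w = deriv (fun w => w) w :=
      EventuallyEq.deriv hgf
    filter_upwards [h1, hgf, hf.eventually_analyticAt, hfc.eventually hg.eventually_analyticAt]
      with w h1 h2 h3 h4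
    have h5 : deriv (fun w => g (f w)) w = deriv g (f w) * deriv f w :=
      deriv_comp w h4.differentiableAt h3.differentiableAt
    rw [h5, deriv_id''] at h1
    rw [h2]
    linear_combination (-(L w * φ w ^ (n + 1))) * h1
  rw [taylorCoeff_congr e, taylorCoeff_comp_mul (P := fun z => L (g z) * deriv g z) hP hf h0
    (by fun_prop) (Nat.lt_succ_self n)]
  rw [Finset.sum_congr rfl fun i hi => by
    rw [taylorCoeff_pow_mul_deriv_mul_pow hf h0 hφ h (Nat.lt_succ_iff.1 (Finset.mem_range.1 hi))]]
  simp

lemma exists_local_inverse {f : ℂ → ℂ} (hf : AnalyticAt ℂ f 0) (h0 : f 0 = 0)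
    (hd : deriv f 0 ≠ 0) : ∃ g : ℂ → ℂ, AnalyticAt ℂ g 0 ∧ g 0 = 0 ∧
      (∀ᶠ w in 𝓝 (0 : ℂ), g (f w) = w) ∧ ∀ᶠ z in 𝓝 (0 : ℂ), f (g z) = z := by
  have h1 := hf.analyticAt_localInverse hd
  have h2 := hf.hasStrictDerivAt.eventually_left_inverse hd
  have h3 := hf.hasStrictDerivAt.eventually_right_inverse hd
  rw [h0] at h1 h3
  refine ⟨_, h1, ?_, h2, h3⟩
  have := h2.self_of_nhds
  rwa [h0] at this

/-! ### The maps `w ↦ w exp ((σ / 2) (1 + w) / (1 - w))` with complex parameter -/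

/-- `w exp ((σ / 2) (1 + w) / (1 - w))`. -/
def coreMap (σ w : ℂ) : ℂ := w * Complex.exp (σ / 2 * ((1 + w) / (1 - w)))

/-- `exp (-(σ / 2) (1 + w) / (1 - w))`. -/
def corePhi (σ w : ℂ) : ℂ := Complex.exp (-(σ / 2 * ((1 + w) / (1 - w))))

/-- `w / (1 - w)`. -/
def eta (w : ℂ) : ℂ := w / (1 - w)

lemma analyticAt_coreMap (σ : ℂ) : AnalyticAt ℂ (coreMap σ) 0 := by
  unfold coreMap
  fun_prop (disch := simp)

lemma analyticAt_corePhi (σ : ℂ) : AnalyticAt ℂ (corePhi σ) 0 := by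
  unfold corePhi
  fun_prop (disch := simp)

lemma analyticAt_eta : AnalyticAt ℂ eta 0 := by
  unfold eta
  fun_prop (disch := simp)

@[simp] lemma eta_zero : eta 0 = 0 := by simp [eta]

@[simp] lemma coreMap_zero (σ : ℂ) : coreMap σ 0 = 0 := by simp [coreMap]

lemma coreMap_zero_left (w : ℂ) : coreMap 0 w = w := by simp [coreMap]

lemma coreMap_mul_corePhi (σ w : ℂ) : coreMap σ w * corePhi σ w = w := by
  rw [coreMap, corePhi, mul_assoc, ← Complex.exp_add]
  simp

lemma eventually_ne_one : ∀ᶠ w in 𝓝 (0 : ℂ), w ≠ 1 :=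
  isOpen_ne.mem_nhds (by simp)

lemma deriv_coreMap_zero_ne_zero (σ : ℂ) : deriv (coreMap σ) 0 ≠ 0 := by
  have h : AnalyticAt ℂ (fun w : ℂ => Complex.exp (σ / 2 * ((1 + w) / (1 - w)))) 0 := by
    fun_prop (disch := simp)
  have : deriv (coreMap σ) 0 = Complex.exp (σ / 2) := by
    unfold coreMap
    rw [deriv_fun_mul differentiableAt_fun_id h.differentiableAt]
    simp
  rw [this]
  exact Complex.exp_ne_zero _

/-- The inverse of `coreMap σ` near the origin. -/
def coreInv (σ : ℂ) : ℂ → ℂ :=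
  (exists_local_inverse (analyticAt_coreMap σ) (coreMap_zero σ)
    (deriv_coreMap_zero_ne_zero σ)).choose

lemma analyticAt_coreInv (σ : ℂ) : AnalyticAt ℂ (coreInv σ) 0 :=
  (exists_local_inverse (analyticAt_coreMap σ) (coreMap_zero σ)
    (deriv_coreMap_zero_ne_zero σ)).choose_spec.1

@[simp] lemma coreInv_zero (σ : ℂ) : coreInv σ 0 = 0 :=
  (exists_local_inverse (analyticAt_coreMap σ) (coreMap_zero σ)
    (deriv_coreMap_zero_ne_zero σ)).choose_spec.2.1

lemma coreInv_coreMap (σ : ℂ) : ∀ᶠ w in 𝓝 (0 : ℂ), coreInv σ (coreMap σ w) = w :=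
  (exists_local_inverse (analyticAt_coreMap σ) (coreMap_zero σ)
    (deriv_coreMap_zero_ne_zero σ)).choose_spec.2.2.1

lemma coreMap_coreInv (σ : ℂ) : ∀ᶠ z in 𝓝 (0 : ℂ), coreMap σ (coreInv σ z) = z :=
  (exists_local_inverse (analyticAt_coreMap σ) (coreMap_zero σ)
    (deriv_coreMap_zero_ne_zero σ)).choose_spec.2.2.2

lemma tendsto_coreInv (σ : ℂ) : Tendsto (coreInv σ) (𝓝 0) (𝓝 0) := by
  have := (analyticAt_coreInv σ).continuousAt.tendsto
  rwa [coreInv_zero] at this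

lemma tendsto_coreMap (σ : ℂ) : Tendsto (coreMap σ) (𝓝 0) (𝓝 0) := by
  have := (analyticAt_coreMap σ).continuousAt.tendsto
  rwa [coreMap_zero] at this

lemma analyticAt_comp_coreInv {H : ℂ → ℂ} (hH : AnalyticAt ℂ H 0) (σ : ℂ) :
    AnalyticAt ℂ (fun z => H (coreInv σ z)) 0 := by
  apply AnalyticAt.fun_comp _ (analyticAt_coreInv σ)
  rwa [coreInv_zero]

/-! ### Coefficients of `H ∘ coreInv σ` -/

/-- The Taylor coefficients of `H ∘ coreInv σ`. -/
def invCoeff (H : ℂ → ℂ) (σ : ℂ) (n : ℕ) : ℂ := taylorCoeff (fun z => H (coreInv σ z)) n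

lemma invCoeff_index_zero (H : ℂ → ℂ) (σ : ℂ) : invCoeff H σ 0 = H 0 := by
  simp [invCoeff, taylorCoeff_zero]

lemma deriv_comp_coreInv {H : ℂ → ℂ} (hH : AnalyticAt ℂ H 0) (σ : ℂ) :
    deriv (fun z => H (coreInv σ z)) =ᶠ[𝓝 0] fun z => deriv H (coreInv σ z) * deriv (coreInv σ) z := by
  filter_upwards [(tendsto_coreInv σ).eventually hH.eventually_analyticAt,
    (analyticAt_coreInv σ).eventually_analyticAt] with z h1 h2
  exact deriv_comp z h1.differentiableAt h2.differentiableAt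

lemma lagrange_coreInv {L : ℂ → ℂ} (hL : AnalyticAt ℂ L 0) (σ : ℂ) (n : ℕ) :
    taylorCoeff (fun z => L (coreInv σ z) * deriv (coreInv σ) z) n =
      taylorCoeff (fun w => L w * corePhi σ w ^ (n + 1)) n :=
  taylorCoeff_comp_mul_deriv (analyticAt_coreMap σ) (coreMap_zero σ) (analyticAt_corePhi σ)
    (Eventually.of_forall (coreMap_mul_corePhi σ)) (analyticAt_coreInv σ) (coreInv_zero σ)
    (coreInv_coreMap σ) hL n

/-- Lagrange inversion applied to `(H ∘ coreInv σ)'`. The dependence on `σ` moves from the implicit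
inverse to the explicit `corePhi σ`. -/
lemma invCoeff_succ {H : ℂ → ℂ} (hH : AnalyticAt ℂ H 0) (σ : ℂ) (n : ℕ) :
    ((n : ℂ) + 1) * invCoeff H σ (n + 1) =
      taylorCoeff (fun w => deriv H w * corePhi σ w ^ (n + 1)) n := by
  rw [invCoeff, ← taylorCoeff_deriv, taylorCoeff_congr (deriv_comp_coreInv hH σ),
    lagrange_coreInv hH.deriv]

lemma taylorCoeff_exp (x : ℂ) (n : ℕ) :
    taylorCoeff (fun z => Complex.exp (x * z)) n = x ^ n / n.factorial := by
  rw [taylorCoeff, iteratedDeriv_cexp_const_mul]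
  simp

lemma taylorCoeff_exp_eta_mul {L : ℂ → ℂ} (hL : AnalyticAt ℂ L 0) (x : ℂ) {n N : ℕ} (h : n < N) :
    taylorCoeff (fun w => Complex.exp (x * eta w) * L w) n =
      ∑ j ∈ Finset.range N, x ^ j / j.factorial * taylorCoeff (fun w => eta w ^ j * L w) n := by
  rw [taylorCoeff_comp_mul (P := fun z => Complex.exp (x * z)) (by fun_prop) analyticAt_eta
    eta_zero hL h]
  simp only [taylorCoeff_exp]

/-- Since `eta 0 = 0`, a fixed coefficient involves finitely many powers of `eta` and is a
polynomial in `x`. -/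
lemma hasDerivAt_taylorCoeff_exp_eta_mul {L : ℂ → ℂ} (hL : AnalyticAt ℂ L 0) (n : ℕ) (x : ℂ) :
    HasDerivAt (fun x => taylorCoeff (fun w => Complex.exp (x * eta w) * L w) n)
      (taylorCoeff (fun w => Complex.exp (x * eta w) * (eta w * L w)) n) x := by
  -- The superfluous term `j = n + 1`, whose coefficient vanishes, leaves exactly `n + 1` terms
  -- after differentiation and index shift.
  have e : (fun x => taylorCoeff (fun w => Complex.exp (x * eta w) * L w) n) = fun x =>
      ∑ j ∈ Finset.range (n + 2), x ^ j / j.factorial *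
        taylorCoeff (fun w => eta w ^ j * L w) n := by
    ext x
    exact taylorCoeff_exp_eta_mul hL x (by omega)
  have h := analyticAt_eta
  rw [e, taylorCoeff_exp_eta_mul (by fun_prop) x (Nat.lt_succ_self n)]
  have h1 : ∀ j ∈ Finset.range (n + 2), HasDerivAt (fun x : ℂ => x ^ j / j.factorial *
      taylorCoeff (fun w => eta w ^ j * L w) n) ((j * x ^ (j - 1)) / j.factorial *
      taylorCoeff (fun w => eta w ^ j * L w) n) x := fun j _ =>
    ((hasDerivAt_pow j x).div_const _).mul_const _
  refine (HasDerivAt.fun_sum h1).congr_deriv ?_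
  rw [Finset.sum_range_succ']
  simp only [Nat.cast_zero, zero_mul, zero_div, add_zero]
  refine Finset.sum_congr rfl fun j _ => ?_
  rw [Nat.factorial_succ, Nat.add_sub_cancel]
  have := factorial_ne_zero' j
  have : (j : ℂ) + 1 ≠ 0 := Nat.cast_add_one_ne_zero j
  simp only [pow_succ, mul_assoc]
  push_cast
  field_simp

/-- This is `(1 + w)/(1 - w) = 1 + 2 eta w`; it is the reason why `eta` governs the whole evolution
in `σ`. -/
lemma corePhi_pow_eq (σ : ℂ) (k : ℕ) {w : ℂ} (hw : w ≠ 1) :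
    corePhi σ w ^ k = Complex.exp (-(k * σ / 2)) * Complex.exp (-(k * σ) * eta w) := by
  have : 1 - w ≠ 0 := sub_ne_zero.2 hw.symm
  rw [corePhi, ← Complex.exp_nat_mul, ← Complex.exp_add, eta]
  congr 1
  field_simp
  ring

lemma taylorCoeff_mul_corePhi_pow {L : ℂ → ℂ} (σ : ℂ) (k n : ℕ) :
    taylorCoeff (fun w => L w * corePhi σ w ^ k) n =
      Complex.exp (-(k * σ / 2)) *
        taylorCoeff (fun w => Complex.exp (-(k * σ) * eta w) * L w) n := by
  rw [← taylorCoeff_const_mul]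
  apply taylorCoeff_congr
  filter_upwards [eventually_ne_one] with w hw
  rw [corePhi_pow_eq σ k hw]
  ring

lemma hasDerivAt_taylorCoeff_mul_corePhi_pow {L : ℂ → ℂ} (hL : AnalyticAt ℂ L 0) (k n : ℕ)
    (σ : ℂ) : HasDerivAt (fun σ => taylorCoeff (fun w => L w * corePhi σ w ^ k) n)
      (-(k / 2) * taylorCoeff (fun w => L w * corePhi σ w ^ k) n
        - k * taylorCoeff (fun w => (eta w * L w) * corePhi σ w ^ k) n) σ := by
  have e : (fun σ => taylorCoeff (fun w => L w * corePhi σ w ^ k) n) = fun σ =>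
      Complex.exp (-(k * σ / 2)) *
        taylorCoeff (fun w => Complex.exp (-(k * σ) * eta w) * L w) n := by
    ext σ
    exact taylorCoeff_mul_corePhi_pow σ k n
  have h1 : HasDerivAt (fun σ : ℂ => Complex.exp (-(k * σ / 2)))
      (Complex.exp (-(k * σ / 2)) * -(k * 1 / 2)) σ :=
    ((((hasDerivAt_id' σ).const_mul (k : ℂ)).div_const 2).neg).cexp
  have h2 : HasDerivAt (fun σ : ℂ => -(k * σ)) (-(k * 1)) σ :=
    ((hasDerivAt_id' σ).const_mul (k : ℂ)).neg
  have h3 := (hasDerivAt_taylorCoeff_exp_eta_mul hL n (-(k * σ))).comp σ h2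
  rw [e]
  refine (h1.mul h3).congr_deriv ?_
  rw [taylorCoeff_mul_corePhi_pow, taylorCoeff_mul_corePhi_pow]
  simp only [Function.comp_apply]
  ring

/-- The triangular system of differential equations satisfied by the coefficients of
`H ∘ coreInv σ`. -/
lemma hasDerivAt_invCoeff {H : ℂ → ℂ} (hH : AnalyticAt ℂ H 0) (n : ℕ) (σ : ℂ) :
    HasDerivAt (fun σ => invCoeff H σ n) (-(n / 2) * invCoeff H σ n
      - ∑ i ∈ Finset.range n, invCoeff eta σ i * (((n : ℂ) - i) * invCoeff H σ (n - i))) σ := by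
  rcases n with _ | n
  · simp only [invCoeff_index_zero]
    simpa using hasDerivAt_const σ (H 0)
  have hn : (n : ℂ) + 1 ≠ 0 := Nat.cast_add_one_ne_zero n
  have e : (fun σ => invCoeff H σ (n + 1)) = fun σ =>
      ((n : ℂ) + 1)⁻¹ * taylorCoeff (fun w => deriv H w * corePhi σ w ^ (n + 1)) n := by
    ext σ
    rw [← invCoeff_succ hH, inv_mul_cancel_left₀ hn]
  have hη := analyticAt_eta
  have hH' : AnalyticAt ℂ (deriv H) 0 := hH.deriv
  -- Lagrange inversion read backwards: this is the coefficient of `(eta ∘ coreInv σ) (H ∘ coreInv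
  -- σ)'`, a Cauchy product.
  have key : taylorCoeff (fun w => (eta w * deriv H w) * corePhi σ w ^ (n + 1)) n =
      ∑ i ∈ Finset.range (n + 1), invCoeff eta σ i *
        ((((n + 1 : ℕ) : ℂ) - i) * invCoeff H σ (n + 1 - i)) := by
    rw [← lagrange_coreInv (L := fun w => eta w * deriv H w) (by fun_prop)]
    have e2 : (fun z => eta (coreInv σ z) * deriv H (coreInv σ z) * deriv (coreInv σ) z) =ᶠ[𝓝 0]
        fun z => eta (coreInv σ z) * deriv (fun z => H (coreInv σ z)) z := by
      filter_upwards [deriv_comp_coreInv hH σ] with z hz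
      rw [hz, mul_assoc]
    rw [taylorCoeff_congr e2, taylorCoeff_mul (analyticAt_comp_coreInv hη σ)
      (analyticAt_comp_coreInv hH σ).deriv]
    refine Finset.sum_congr rfl fun i hi => ?_
    have hi : i ≤ n := Nat.lt_succ_iff.1 (Finset.mem_range.1 hi)
    rw [taylorCoeff_deriv, show n + 1 - i = n - i + 1 by omega, Nat.cast_sub hi]
    push_cast
    simp only [invCoeff]
    ring
  rw [e]
  refine ((hasDerivAt_taylorCoeff_mul_corePhi_pow hH' (n + 1) n σ).const_mul _).congr_deriv ?_
  rw [key, ← invCoeff_succ hH]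
  push_cast
  field_simp

/-! ### The numbers `ν_k` -/

/-- Multiplication by `1 - w` lowers the exponent by one, which on coefficients is Pascal's rule. -/
lemma taylorCoeff_one_sub_inv_pow (d m : ℕ) :
    taylorCoeff (fun w => ((1 - w)⁻¹) ^ (d + 1)) m = ((d + m).choose d : ℂ) := by
  have ha (d : ℕ) : AnalyticAt ℂ (fun w : ℂ => ((1 - w)⁻¹) ^ d) 0 := by fun_prop (disch := simp)
  have step (d : ℕ) (m : ℕ) : taylorCoeff (fun w => ((1 - w)⁻¹) ^ d) (m + 1) =
      taylorCoeff (fun w => ((1 - w)⁻¹) ^ (d + 1)) (m + 1) -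
        taylorCoeff (fun w => ((1 - w)⁻¹) ^ (d + 1)) m := by
    have h1 : (fun w : ℂ => ((1 - w)⁻¹) ^ d) =ᶠ[𝓝 0]
        fun w => ((1 - w)⁻¹) ^ (d + 1) - w ^ 1 * ((1 - w)⁻¹) ^ (d + 1) := by
      filter_upwards [eventually_ne_one] with w hw
      have := mul_inv_cancel₀ (sub_ne_zero.2 hw.symm)
      linear_combination (-((1 - w)⁻¹ ^ d)) * this
    have := ha (d + 1)
    rw [taylorCoeff_congr h1, taylorCoeff_sub this (by fun_prop), taylorCoeff_pow_mul this,
      if_pos (by omega), Nat.add_sub_cancel]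
  induction d generalizing m with
  | zero =>
    induction m with
    | zero => simp [taylorCoeff_zero]
    | succ m ih =>
      have := step 0 m
      rw [ih] at this
      simp only [pow_zero, taylorCoeff_const] at this
      simp at this ⊢
      linear_combination -this
  | succ d ih =>
    induction m with
    | zero => simp [taylorCoeff_zero]
    | succ m ihm =>
      have := step (d + 1) m
      rw [ihm, ih] at this
      rw [show d + 1 + (m + 1) = (d + (m + 1)) + 1 by ring, Nat.choose_succ_succ,
        show d + (m + 1) = d + 1 + m by ring] at *
      push_cast
      linear_combination -this

/-- With `|k| = n + 1`, Lagrange inversion reduces this to the coefficient of `(1-w)⁻² exp(-(n+1) s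
η)`. The `j`-th term of the exponential produces the `j`-th summand of `ν_k`, since `η^j (1-w)⁻² =
w^j (1-w)^{-(j+2)}` has `n`-th coefficient `binom(n+1, j+1)`. -/
lemma invCoeff_eta_eq_nu (k : ℤ) (hk : k ≠ 0) (s : ℝ) :
    invCoeff eta (s : ℂ) k.natAbs = ((nu k s : ℝ) : ℂ) := by
  obtain ⟨n, hn⟩ : ∃ n, k.natAbs = n + 1 := ⟨k.natAbs - 1, by omega⟩
  rw [nu, if_neg hk, hn]
  have hn0 : (n : ℂ) + 1 ≠ 0 := Nat.cast_add_one_ne_zero n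
  apply mul_left_cancel₀ hn0
  have hd : (fun w => deriv eta w * corePhi s w ^ (n + 1)) =ᶠ[𝓝 0]
      fun w => ((1 - w)⁻¹) ^ 2 * corePhi s w ^ (n + 1) := by
    filter_upwards [eventually_ne_one] with w hw
    have h1 : 1 - w ≠ 0 := sub_ne_zero.2 hw.symm
    congr 1
    have : HasDerivAt eta ((1 * (1 - w) - w * (-1)) / (1 - w) ^ 2) w :=
      (hasDerivAt_id' w).div ((hasDerivAt_id' w).const_sub 1) h1
    rw [this.deriv]
    field_simp
    ring
  have ha (d : ℕ) : AnalyticAt ℂ (fun w : ℂ => ((1 - w)⁻¹) ^ d) 0 := by fun_prop (disch := simp)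
  rw [invCoeff_succ analyticAt_eta, taylorCoeff_congr hd, taylorCoeff_mul_corePhi_pow,
    taylorCoeff_exp_eta_mul (ha 2) _ (Nat.lt_succ_self n)]
  push_cast
  rw [mul_left_comm]
  refine congrArg₂ (· * ·) (by congr 1; ring) ?_
  rw [Finset.mul_sum]
  refine Finset.sum_congr rfl fun j hj => ?_
  have hj : j ≤ n := Nat.lt_succ_iff.1 (Finset.mem_range.1 hj)
  have e : (fun w : ℂ => eta w ^ j * ((1 - w)⁻¹) ^ 2) =
      fun w => w ^ j * ((1 - w)⁻¹) ^ (j + 1 + 1) := by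
    ext w
    rw [eta]
    ring
  rw [e, taylorCoeff_pow_mul (ha _), if_pos hj, taylorCoeff_one_sub_inv_pow,
    show j + 1 + (n - j) = n + 1 by omega, zpow_sub_one₀ hn0, zpow_natCast, neg_mul_eq_mul_neg,
    mul_pow]
  field_simp

/-! ### Locally finite vectors and exponentials of operators -/

section LocallyFinite

variable {V V₁ V₂ V₃ : Type*} [AddCommGroup V] [Module ℂ V] [AddCommGroup V₁] [Module ℂ V₁]
  [AddCommGroup V₂] [Module ℂ V₂] [AddCommGroup V₃] [Module ℂ V₃]

/-- The subspace of the vectors contained in a finite-dimensional subspace invariant under `A`. -/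
def locallyFinite (A : V →ₗ[ℂ] V) : Submodule ℂ V where
  carrier := {x | ∃ W : Submodule ℂ V, W.FG ∧ (∀ y ∈ W, A y ∈ W) ∧ x ∈ W}
  zero_mem' := ⟨⊥, Submodule.fg_bot, by simp, by simp⟩
  add_mem' := by
    rintro x y ⟨W, hW, hA, hx⟩ ⟨W', hW', hA', hy⟩
    refine ⟨W ⊔ W', hW.sup hW', fun z hz => ?_, Submodule.add_mem_sup hx hy⟩
    obtain ⟨a, ha, b, hb, rfl⟩ := Submodule.mem_sup.1 hz
    rw [map_add]
    exact Submodule.add_mem_sup (hA a ha) (hA' b hb)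
  smul_mem' := by
    rintro c x ⟨W, hW, hA, hx⟩
    exact ⟨W, hW, hA, W.smul_mem c hx⟩

/-- Adjoining `x` to an invariant space containing `A x - c x` keeps it invariant. This is the
induction step for triangular operators. -/
lemma mem_locallyFinite_of_apply_sub_smul_mem {A : V →ₗ[ℂ] V} {x : V} {c : ℂ}
    (h : A x - c • x ∈ locallyFinite A) : x ∈ locallyFinite A := by
  obtain ⟨W, hW, hA, hx⟩ := h
  have hs : x ∈ Submodule.span ℂ {x} := Submodule.mem_span_singleton_self x
  refine ⟨Submodule.span ℂ {x} ⊔ W, (Submodule.fg_span_singleton x).sup hW, fun z hz => ?_,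
    Submodule.mem_sup_left hs⟩
  obtain ⟨a, ha, b, hb, rfl⟩ := Submodule.mem_sup.1 hz
  obtain ⟨r, rfl⟩ := Submodule.mem_span_singleton.1 ha
  have : A (r • x + b) = (r * c) • x + (r • (A x - c • x) + A b) := by
    rw [map_add, map_smul, smul_sub, smul_smul]
    abel
  rw [this]
  exact Submodule.add_mem_sup (Submodule.smul_mem _ _ hs)
    (W.add_mem (W.smul_mem r hx) (hA b hb))

/-- By the Leibniz rule `hB`, the span of the products of two invariant spaces is invariant. -/
lemma map₂_mem_locallyFinite {A₁ : V₁ →ₗ[ℂ] V₁} {A₂ : V₂ →ₗ[ℂ] V₂} {A₃ : V₃ →ₗ[ℂ] V₃}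
    (B : V₁ →ₗ[ℂ] V₂ →ₗ[ℂ] V₃) (hB : ∀ x y, A₃ (B x y) = B (A₁ x) y + B x (A₂ y))
    {x : V₁} {y : V₂} (hx : x ∈ locallyFinite A₁) (hy : y ∈ locallyFinite A₂) :
    B x y ∈ locallyFinite A₃ := by
  obtain ⟨W₁, h₁, hA₁, hx⟩ := hx
  obtain ⟨W₂, h₂, hA₂, hy⟩ := hy
  refine ⟨Submodule.map₂ B W₁ W₂, h₁.map₂ B h₂, fun z hz => ?_, Submodule.apply_mem_map₂ B hx hy⟩
  have : Submodule.map₂ B W₁ W₂ ≤ (Submodule.map₂ B W₁ W₂).comap A₃ := by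
    rw [Submodule.map₂_le]
    intro a ha b hb
    rw [Submodule.mem_comap, hB]
    exact add_mem (Submodule.apply_mem_map₂ B (hA₁ a ha) hb)
      (Submodule.apply_mem_map₂ B ha (hA₂ b hb))
  exact this hz

lemma smul_mem_locallyFinite {A : V →ₗ[ℂ] V} {x : V} (c : ℂ) (hx : x ∈ locallyFinite A) :
    x ∈ locallyFinite (c • A) := by
  obtain ⟨W, hW, hA, hx⟩ := hx
  exact ⟨W, hW, fun y hy => W.smul_mem c (hA y hy), hx⟩

/-- In coordinates on the invariant subspace this is the matrix exponential; a functional on `V`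
restricts to a continuous one there. -/
lemma exists_isExpApply {A : V →ₗ[ℂ] V} {x : V} (hx : x ∈ locallyFinite A) :
    ∃ w, IsExpApply A x w := by
  obtain ⟨W, hW, hA, hx⟩ := hx
  have : Module.Finite ℂ W := Module.Finite.iff_fg.2 hW
  let e := (Module.finBasis ℂ W).equivFun
  let A' : W →ₗ[ℂ] W := A.restrict hA
  let M : (Fin (Module.finrank ℂ W) → ℂ) →L[ℂ] (Fin (Module.finrank ℂ W) → ℂ) :=
    LinearMap.toContinuousLinearMap (e.toLinearMap ∘ₗ A' ∘ₗ e.symm.toLinearMap)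
  have hM : ∀ n : ℕ, ∀ y : W, (M ^ n) (e y) = e ((A' ^ n) y) := by
    intro n
    induction n with
    | zero => intro y; simp
    | succ n ih =>
      intro y
      have : M (e y) = e (A' y) := by simp [M]
      rw [pow_succ, mul_apply_eq_comp, this, ih, pow_succ, Module.End.mul_apply]
  have hA' : ∀ n : ℕ, ∀ y : W, (((A' ^ n) y : W) : V) = (A ^ n) y := by
    intro n
    induction n with
    | zero => intro y; simp
    | succ n ih =>
      intro y
      rw [pow_succ, Module.End.mul_apply, ih, pow_succ, Module.End.mul_apply]
      rfl
  refine ⟨(e.symm (NormedSpace.exp M (e ⟨x, hx⟩)) : W), fun φ => ?_⟩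
  have h1 : HasSum (fun n : ℕ => ((n.factorial : ℂ))⁻¹ • M ^ n) (NormedSpace.exp M) :=
    NormedSpace.exp_series_hasSum_exp' M
  have h2 := (ContinuousLinearMap.apply ℂ (Fin (Module.finrank ℂ W) → ℂ) (e ⟨x, hx⟩)).hasSum h1
  have h3 := (LinearMap.toContinuousLinearMap
    (φ ∘ₗ W.subtype ∘ₗ e.symm.toLinearMap)).hasSum h2
  refine (h3.congr_fun ?_)
  intro n
  simp [hM, hA']

lemma isExpApply_expApply {A : V →ₗ[ℂ] V} {x : V} (hx : x ∈ locallyFinite A) :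
    IsExpApply A x (expApply A x) :=
  Classical.epsilon_spec (exists_isExpApply hx)

end LocallyFinite

/-! ### The operator `𝒟` -/

lemma onMonomials_single (F : ℤ → VPoly →ₗ[ℂ] TracePoly) (n : ℤ) (q : VPoly) :
    onMonomials F (AddMonoidAlgebra.single n q) = F n q := by
  simp [onMonomials, -LaurentPolynomial.single_eq_C_mul_T]

/-- The derivation of `ℂ[v]` by which `𝒟` acts on the coefficients. -/
def coeffDer : Derivation ℂ VPoly VPoly :=
  MvPolynomial.mkDerivation ℂ fun k : TraceIdx =>
    -(((|k.1| : ℤ) : ℂ) • v k.1) - (2 : ℂ) • zCoeff k.1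

lemma coeffDer_eq (q : VPoly) :
    coeffDer q = -(MvPolynomial.mkDerivation ℂ (fun k : TraceIdx => ((|k.1| : ℤ) : ℂ) • v k.1) q)
      - (2 : ℂ) • MvPolynomial.mkDerivation ℂ (fun k : TraceIdx => zCoeff k.1) q := by
  have : coeffDer = -(MvPolynomial.mkDerivation ℂ (fun k : TraceIdx => ((|k.1| : ℤ) : ℂ) • v k.1))
      - (2 : ℂ) • MvPolynomial.mkDerivation ℂ (fun k : TraceIdx => zCoeff k.1) := by
    apply MvPolynomial.derivation_ext
    intro k
    simp [coeffDer, MvPolynomial.mkDerivation_X]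
  rw [this]
  rfl

lemma opD_single (n : ℤ) (q : VPoly) :
    opD (AddMonoidAlgebra.single n q) = AddMonoidAlgebra.single n (coeffDer q)
      - ((|n| : ℤ) : ℂ) • AddMonoidAlgebra.single n q
      - (2 : ℂ) • (AddMonoidAlgebra.single 0 q * yPow n) := by
  simp only [opD, opN0, opN1, opZ, opY, onCoeffs, LinearMap.sub_apply, LinearMap.neg_apply,
    LinearMap.add_apply, LinearMap.smul_apply, onMonomials_single, coeffDer_eq,
    LinearMap.comp_apply, AddMonoidAlgebra.lsingle_apply, LinearMap.mulRight_apply,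
    AddMonoidAlgebra.single_sub, AddMonoidAlgebra.single_neg, ← AddMonoidAlgebra.smul_single]
  simp only [Derivation.coeFn_coe]
  abel

lemma tracePoly_induction {P : TracePoly → Prop} (x : TracePoly) (h0 : P 0)
    (hadd : ∀ x y, P x → P y → P (x + y)) (hs : ∀ n q, P (AddMonoidAlgebra.single n q)) : P x :=
  AddMonoidAlgebra.induction_linear x h0 hadd hs

/-- `𝒩₁` and `𝒴` are `ℂ[v]`-linear, so `𝒟` fails to be `ℂ[v]`-linear only through the derivation
`coeffDer`. -/
lemma opD_coeff_mul (q : VPoly) (x : TracePoly) :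
    opD (AddMonoidAlgebra.single 0 q * x) =
      AddMonoidAlgebra.single 0 (coeffDer q) * x + AddMonoidAlgebra.single 0 q * opD x := by
  induction x using tracePoly_induction with
  | h0 => simp
  | hadd x y hx hy => rw [mul_add, map_add, hx, hy, map_add]; ring
  | hs n r =>
    have h : (AddMonoidAlgebra.single 0 q * (AddMonoidAlgebra.single 0 r * yPow n) : TracePoly) =
        AddMonoidAlgebra.single 0 (q * r) * yPow n := by
      rw [← mul_assoc, AddMonoidAlgebra.single_mul_single, zero_add]
    simp only [opD_single, mul_sub, AddMonoidAlgebra.single_mul_single, zero_add, h,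
      Derivation.leibniz, mul_smul_comm, AddMonoidAlgebra.single_add, smul_eq_mul, mul_comm r]
    rw [add_comm (AddMonoidAlgebra.single n (q * coeffDer r)), add_sub_assoc, add_sub_assoc]

/-- Triangularity: up to the eigenvalue `-|k|`, `coeffDer` sends `v_k` to products of variables of
strictly smaller index. -/
lemma v_mem_locallyFinite (k : ℤ) : v k ∈ locallyFinite coeffDer.toLinearMap := by
  induction hN : k.natAbs using Nat.strong_induction_on generalizing k with
  | _ N ih =>
    by_cases hk : k = 0
    · refine mem_locallyFinite_of_apply_sub_smul_mem (c := 0) ?_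
      have : v k = 1 := by simp [v, hk]
      rw [this]
      simp
    have hv : v k = MvPolynomial.X ⟨k, hk⟩ := by simp [v, hk]
    refine mem_locallyFinite_of_apply_sub_smul_mem (c := -((|k| : ℤ) : ℂ)) ?_
    have e : coeffDer.toLinearMap (v k) - (-((|k| : ℤ) : ℂ)) • v k = -((2 : ℂ) • zCoeff k) := by
      rw [Derivation.coeFn_coe]
      conv_lhs => enter [1]; rw [hv, coeffDer, MvPolynomial.mkDerivation_X]
      rw [neg_smul]
      abel
    rw [e]
    refine neg_mem (Submodule.smul_mem _ _ ?_)
    have hmul (i j : ℤ) (hi : i.natAbs < N) (hj : j.natAbs < N) :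
        v i * v j ∈ locallyFinite coeffDer.toLinearMap :=
      map₂_mem_locallyFinite (LinearMap.mul ℂ VPoly)
        (fun x y => by simp [Derivation.leibniz, mul_comm, add_comm])
        (ih _ hi i rfl) (ih _ hj j rfl)
    rw [zCoeff]
    split_ifs with h
    · refine Submodule.sum_mem _ fun j hj => Submodule.smul_mem _ _ ?_
      rw [Finset.mem_Icc] at hj
      exact hmul _ _ (by omega) (by omega)
    · refine neg_mem (Submodule.sum_mem _ fun j hj => Submodule.smul_mem _ _ ?_)
      rw [Finset.mem_Icc] at hj
      exact hmul _ _ (by omega) (by omega)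

lemma vPoly_mem_locallyFinite (q : VPoly) : q ∈ locallyFinite coeffDer.toLinearMap := by
  induction q using MvPolynomial.induction_on with
  | C a =>
    refine mem_locallyFinite_of_apply_sub_smul_mem (c := 0) ?_
    simp
  | add p q hp hq => exact add_mem hp hq
  | mul_X p k hp =>
    refine map₂_mem_locallyFinite (A₁ := coeffDer.toLinearMap) (A₂ := coeffDer.toLinearMap)
      (LinearMap.mul ℂ VPoly) (fun x y => by simp [Derivation.leibniz, mul_comm, add_comm]) hp ?_
    have : v k.1 = MvPolynomial.X k := by simp [v, k.2]
    rw [← this]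
    exact v_mem_locallyFinite k.1

lemma coeff_mul_mem_locallyFinite {x : TracePoly} (hx : x ∈ locallyFinite opD) (q : VPoly) :
    AddMonoidAlgebra.single 0 q * x ∈ locallyFinite opD :=
  map₂_mem_locallyFinite
    ((LinearMap.mul ℂ TracePoly) ∘ₗ (AddMonoidAlgebra.lsingle 0 : VPoly →ₗ[ℂ] TracePoly))
    (fun q x => opD_coeff_mul q x) (vPoly_mem_locallyFinite q) hx

/-- Triangularity again: `yPow n` contains only powers of `u` of smaller absolute exponent. The
coefficient `q` is split off by `coeff_mul_mem_locallyFinite`. -/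
lemma single_mem_locallyFinite (n : ℤ) (q : VPoly) :
    AddMonoidAlgebra.single n q ∈ locallyFinite opD := by
  induction hN : n.natAbs using Nat.strong_induction_on generalizing n q with
  | _ N ih =>
    suffices h : (AddMonoidAlgebra.single n 1 : TracePoly) ∈ locallyFinite opD by
      have := coeff_mul_mem_locallyFinite h q
      rwa [AddMonoidAlgebra.single_mul_single, zero_add, mul_one] at this
    refine mem_locallyFinite_of_apply_sub_smul_mem (c := -((|n| : ℤ) : ℂ)) ?_
    have e : opD (AddMonoidAlgebra.single n 1) -
        (-((|n| : ℤ) : ℂ)) • AddMonoidAlgebra.single n (1 : VPoly) = -((2 : ℂ) • yPow n) := by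
      rw [opD_single, ← AddMonoidAlgebra.one_def, neg_smul, Derivation.map_one_eq_zero,
        AddMonoidAlgebra.single_zero, one_mul]
      abel
    rw [e]
    refine neg_mem (Submodule.smul_mem _ _ ?_)
    rw [yPow]
    split_ifs with h
    · refine Submodule.sum_mem _ fun j hj => ?_
      rw [Finset.mem_Icc] at hj
      exact ih _ (by omega) _ _ rfl
    · refine neg_mem (Submodule.sum_mem _ fun j hj => ?_)
      rw [Finset.mem_Icc] at hj
      exact ih _ (by omega) _ _ rfl

lemma mem_locallyFinite_opD (x : TracePoly) : x ∈ locallyFinite opD := by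
  induction x using tracePoly_induction with
  | h0 => exact zero_mem _
  | hadd x y hx hy => exact add_mem hx hy
  | hs n q => exact single_mem_locallyFinite n q

lemma isExpApply_opD (c : ℂ) (x : TracePoly) : IsExpApply (c • opD) x (expApply (c • opD) x) :=
  isExpApply_expApply (smul_mem_locallyFinite c (mem_locallyFinite_opD x))

/-! ### Polynomials are mapped to polynomials -/

/-- The trace polynomials without negative powers of `u`. -/
def nonnegPart : Submodule ℂ TracePoly :=
  Submodule.span ℂ {x | ∃ n : ℤ, ∃ q : VPoly, 0 ≤ n ∧ x = AddMonoidAlgebra.single n q}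

lemma single_mem_nonnegPart {n : ℤ} (hn : 0 ≤ n) (q : VPoly) :
    AddMonoidAlgebra.single n q ∈ nonnegPart := Submodule.subset_span ⟨n, q, hn, rfl⟩

lemma opD_mem_nonnegPart {x : TracePoly} (hx : x ∈ nonnegPart) : opD x ∈ nonnegPart := by
  induction hx using Submodule.span_induction with
  | mem x h =>
    obtain ⟨n, q, hn, rfl⟩ := h
    rw [opD_single]
    refine sub_mem (sub_mem (single_mem_nonnegPart hn _)
      (Submodule.smul_mem _ _ (single_mem_nonnegPart hn _))) (Submodule.smul_mem _ _ ?_)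
    rw [yPow, if_pos hn, Finset.mul_sum]
    refine Submodule.sum_mem _ fun j hj => ?_
    rw [Finset.mem_Icc] at hj
    rw [AddMonoidAlgebra.single_mul_single]
    exact single_mem_nonnegPart (by omega) _
  | zero => simp
  | add x y _ _ hx hy => rw [map_add]; exact add_mem hx hy
  | smul c x _ hx => rw [map_smul]; exact Submodule.smul_mem _ _ hx

/-! ### Evaluation functionals -/

/-- The functional `u ^ n * q(v) ↦ b n * q(a)`. -/
def evalFun (b : ℤ → ℂ) (a : TraceIdx → ℂ) : TracePoly →ₗ[ℂ] ℂ :=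
  Finsupp.lsum ℂ (fun n => b n • (MvPolynomial.aeval a : VPoly →ₐ[ℂ] ℂ).toLinearMap) ∘ₗ
    (AddMonoidAlgebra.coeffLinearEquiv ℂ).toLinearMap

lemma evalFun_single (b : ℤ → ℂ) (a : TraceIdx → ℂ) (n : ℤ) (q : VPoly) :
    evalFun b a (AddMonoidAlgebra.single n q) = b n * MvPolynomial.aeval a q := by
  simp [evalFun, -LaurentPolynomial.single_eq_C_mul_T]

lemma evalFun_coeff_mul (b : ℤ → ℂ) (a : TraceIdx → ℂ) (q : VPoly) (x : TracePoly) :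
    evalFun b a (AddMonoidAlgebra.single 0 q * x) = MvPolynomial.aeval a q * evalFun b a x := by
  induction x using tracePoly_induction with
  | h0 => simp
  | hadd x y hx hy => rw [mul_add, map_add, hx, hy, map_add, mul_add]
  | hs n r =>
    rw [AddMonoidAlgebra.single_mul_single, zero_add, evalFun_single, evalFun_single, map_mul]
    ring

/-- The functional on `ℂ[u, u⁻¹]` with `u ^ n ↦ b n`. -/
def evalLaurent (b : ℤ → ℂ) (f : ℂ[T;T⁻¹]) : ℂ := f.coeff.sum fun k a => a * b k

lemma evalLaurent_add (b : ℤ → ℂ) (f g : ℂ[T;T⁻¹]) :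
    evalLaurent b (f + g) = evalLaurent b f + evalLaurent b g := by
  rw [evalLaurent, AddMonoidAlgebra.coeff_add]
  exact Finsupp.sum_add_index' (by simp) (by intros; ring)

lemma evalLaurent_single (b : ℤ → ℂ) (n : ℤ) (c : ℂ) :
    evalLaurent b (AddMonoidAlgebra.single n c) = c * b n := by
  simp [evalLaurent, -LaurentPolynomial.single_eq_C_mul_T]

lemma evalLaurent_zero (b : ℤ → ℂ) : evalLaurent b 0 = 0 := by
  simp [evalLaurent]

lemma evalAt_eq_evalLaurent (f : ℂ[T;T⁻¹]) (z : ℂ) : evalAt f z = evalLaurent (fun k => z ^ k) f :=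
  rfl

lemma evalLaurent_traceEval (b : ℤ → ℂ) (s : ℝ) (x : TracePoly) :
    evalLaurent b (traceEval s x) = evalFun b (fun k => ((nu k.1 s : ℝ) : ℂ)) x := by
  induction x using tracePoly_induction with
  | h0 => simp [evalLaurent_zero]
  | hadd x y hx hy => rw [map_add, evalLaurent_add, hx, hy, map_add]
  | hs n q =>
    rw [evalFun_single, traceEval, AddMonoidAlgebra.mapRingHom_single, evalLaurent_single, mul_comm]
    rfl

lemma evalFun_incl (b : ℤ → ℂ) (a : TraceIdx → ℂ) (f : ℂ[T;T⁻¹]) :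
    evalFun b a (incl f) = evalLaurent b f := by
  induction f using AddMonoidAlgebra.induction_linear with
  | zero => simp [evalLaurent_zero]
  | add x y hx hy => rw [map_add, map_add, hx, hy, evalLaurent_add]
  | single n q =>
    rw [incl, AddMonoidAlgebra.mapRingHom_single, evalFun_single, evalLaurent_single,
      MvPolynomial.aeval_C, mul_comm]
    rfl

/-! ### The flow of the evaluation functionals -/

/-- The values `ν_k` with complex parameter. -/
def flowA (σ : ℂ) : TraceIdx → ℂ := fun k => invCoeff eta σ k.1.natAbs

/-- The coefficients of `Hp ∘ coreInv σ` (for `n > 0`) and of `Hm ∘ coreInv σ` (for `n < 0`). -/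
def flowB (Hp Hm : ℂ → ℂ) (σ : ℂ) : ℤ → ℂ := fun n =>
  if n = 0 then 1 else invCoeff (if 0 < n then Hp else Hm) σ n.natAbs

/-- `u ^ n * q(v) ↦ flowB n * q(flowA)`. -/
def flow (Hp Hm : ℂ → ℂ) (σ : ℂ) : TracePoly →ₗ[ℂ] ℂ := evalFun (flowB Hp Hm σ) (flowA σ)

lemma sum_Icc_one_eq_sum_range (F : ℤ → ℂ) (N : ℕ) :
    ∑ k ∈ Finset.Icc (1 : ℤ) (N - 1), F k =
      ∑ i ∈ Finset.range N, if i = 0 then 0 else F i := by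
  rw [Finset.sum_ite, Finset.sum_const_zero, zero_add]
  refine Finset.sum_nbij' Int.toNat (fun i => (i : ℤ)) ?_ ?_ ?_ ?_ ?_
  · intro k hk; simp only [Finset.mem_Icc, Finset.mem_filter, Finset.mem_range] at *; omega
  · intro k hk; simp only [Finset.mem_Icc, Finset.mem_filter, Finset.mem_range] at *; omega
  · intro k hk; simp only [Finset.mem_Icc] at *; omega
  · intro k hk; simp
  · intro k hk
    simp only [Finset.mem_Icc] at hk
    rw [Int.toNat_of_nonneg (by omega)]

lemma sum_Icc_neg_one_eq_sum_range (F : ℤ → ℂ) (N : ℕ) :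
    ∑ k ∈ Finset.Icc (-(N : ℤ) + 1) (-1), F k =
      ∑ i ∈ Finset.range N, if i = 0 then 0 else F (-i) := by
  rw [← sum_Icc_one_eq_sum_range (fun k => F (-k))]
  refine Finset.sum_nbij' (fun k => -k) (fun k => -k) ?_ ?_ ?_ ?_ ?_
  · intro k hk; simp only [Finset.mem_Icc] at *; omega
  · intro k hk; simp only [Finset.mem_Icc] at *; omega
  · intro k hk; simp
  · intro k hk; simp
  · intro k hk; simp

lemma aeval_flowA_v (σ : ℂ) {k : ℤ} (hk : k ≠ 0) :
    MvPolynomial.aeval (flowA σ) (v k) = invCoeff eta σ k.natAbs := by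
  rw [v, dif_pos hk, MvPolynomial.aeval_X, flowA]

/-- `𝒵` puts the weight on the first factor `v_j`, the differential system on the second; the
reflection `i ↦ N - i` exchanges them. -/
lemma sum_range_mul_comm (a : ℕ → ℂ) (h0 : a 0 = 0) (N : ℕ) :
    ∑ i ∈ Finset.range N, (i : ℂ) * (a i * a (N - i)) =
      ∑ i ∈ Finset.range N, a i * (((N : ℂ) - i) * a (N - i)) := by
  have h1 : ∑ i ∈ Finset.range (N + 1), (i : ℂ) * (a i * a (N - i)) =
      ∑ i ∈ Finset.range N, (i : ℂ) * (a i * a (N - i)) := by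
    rw [Finset.sum_range_succ, Nat.sub_self, h0]; simp
  have h2 : ∑ i ∈ Finset.range (N + 1), a i * (((N : ℂ) - i) * a (N - i)) =
      ∑ i ∈ Finset.range N, a i * (((N : ℂ) - i) * a (N - i)) := by
    rw [Finset.sum_range_succ, Nat.sub_self, h0]; simp
  rw [← h1, ← h2, ← Finset.sum_range_reflect]
  refine Finset.sum_congr rfl fun i hi => ?_
  have hi : i ≤ N := Nat.lt_succ_iff.1 (Finset.mem_range.1 hi)
  rw [show N + 1 - 1 - i = N - i by omega, Nat.cast_sub hi, show N - (N - i) = i by omega]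
  ring

/-- Both signs of `k` give the same sum: for `k < 0` the leading minus cancels the sign of the
negative weights `j`. -/
lemma aeval_flowA_zCoeff (σ : ℂ) (k : ℤ) :
    MvPolynomial.aeval (flowA σ) (zCoeff k) = ∑ i ∈ Finset.range k.natAbs,
      invCoeff eta σ i * (((k.natAbs : ℂ) - i) * invCoeff eta σ (k.natAbs - i)) := by
  rw [← sum_range_mul_comm _ (by rw [invCoeff_index_zero, eta_zero])]
  rw [zCoeff]
  split_ifs with h
  · obtain ⟨N, rfl⟩ := Int.eq_ofNat_of_zero_le h.le
    rw [map_sum, sum_Icc_one_eq_sum_range]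
    refine Finset.sum_congr rfl fun i hi => ?_
    rw [Finset.mem_range] at hi
    split_ifs with h0
    · simp [h0]
    · rw [map_smul, map_mul, aeval_flowA_v _ (by omega), aeval_flowA_v _ (by omega), smul_eq_mul,
        show ((N : ℤ) - i).natAbs = N - i by omega]
      simp
  · obtain ⟨N, hN⟩ := Int.eq_ofNat_of_zero_le (show 0 ≤ -k by omega)
    obtain rfl : k = -(N : ℤ) := by omega
    rw [map_neg, map_sum, sum_Icc_neg_one_eq_sum_range, ← Finset.sum_neg_distrib, Int.natAbs_neg,
      Int.natAbs_natCast]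
    refine Finset.sum_congr rfl fun i hi => ?_
    rw [Finset.mem_range] at hi
    split_ifs with h0
    · simp [h0]
    · rw [map_smul, map_mul, aeval_flowA_v _ (by omega), aeval_flowA_v _ (by omega), smul_eq_mul,
        show (-(N : ℤ) - -i).natAbs = N - i by omega]
      simp

lemma flow_yPow (Hp Hm : ℂ → ℂ) (σ : ℂ) (n : ℤ) :
    flow Hp Hm σ (yPow n) = ∑ i ∈ Finset.range n.natAbs, invCoeff eta σ i *
      (((n.natAbs : ℂ) - i) * invCoeff (if 0 < n then Hp else Hm) σ (n.natAbs - i)) := by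
  have h0 : invCoeff eta σ 0 = 0 := by rw [invCoeff_index_zero, eta_zero]
  rw [yPow]
  split_ifs with h h' h'
  · obtain ⟨N, rfl⟩ := Int.eq_ofNat_of_zero_le h
    rw [map_sum, sum_Icc_one_eq_sum_range]
    refine Finset.sum_congr rfl fun i hi => ?_
    rw [Int.natAbs_natCast, Finset.mem_range] at hi
    split_ifs with hi0
    · simp [hi0, h0]
    · rw [flow, evalFun_single, map_smul, aeval_flowA_v _ (by omega), smul_eq_mul, flowB,
        if_neg (by omega), if_pos (by omega), show ((N : ℤ) - i).natAbs = N - i by omega]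
      simp
      ring
  · obtain rfl : n = 0 := by omega
    simp
  · omega
  · obtain ⟨N, hN⟩ := Int.eq_ofNat_of_zero_le (show 0 ≤ -n by omega)
    obtain rfl : n = -(N : ℤ) := by omega
    rw [map_neg, map_sum, sum_Icc_neg_one_eq_sum_range, ← Finset.sum_neg_distrib, Int.natAbs_neg,
      Int.natAbs_natCast]
    refine Finset.sum_congr rfl fun i hi => ?_
    rw [Finset.mem_range] at hi
    split_ifs with hi0
    · simp [hi0, h0]
    · rw [flow, evalFun_single, map_smul, aeval_flowA_v _ (by omega), smul_eq_mul, flowB,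
        if_neg (by omega), if_neg (by omega), show (-(N : ℤ) - -i).natAbs = N - i by omega]
      simp
      ring

/-- The speed `2` turns the factors `-1/2` and `-1` of the system into the `-1` and `-2` of `𝒟 = -𝒩
- 2𝒵 - 2𝒴`. -/
lemma hasDerivAt_invCoeff_flow {H : ℂ → ℂ} (hH : AnalyticAt ℂ H 0) (n : ℕ) (σ τ : ℂ) :
    HasDerivAt (fun τ => invCoeff H (σ + 2 * τ) n) (-(n * invCoeff H (σ + 2 * τ) n)
      - 2 * ∑ i ∈ Finset.range n, invCoeff eta (σ + 2 * τ) i *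
        (((n : ℂ) - i) * invCoeff H (σ + 2 * τ) (n - i))) τ := by
  have h1 : HasDerivAt (fun τ : ℂ => σ + 2 * τ) (2 * 1) τ :=
    ((hasDerivAt_id' τ).const_mul 2).const_add σ
  refine ((hasDerivAt_invCoeff hH n (σ + 2 * τ)).comp τ h1).congr_deriv ?_
  ring

lemma hasDerivAt_aeval_flowA (σ τ : ℂ) (q : VPoly) :
    HasDerivAt (fun τ => MvPolynomial.aeval (flowA (σ + 2 * τ)) q)
      (MvPolynomial.aeval (flowA (σ + 2 * τ)) (coeffDer q)) τ := by
  induction q using MvPolynomial.induction_on with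
  | C a => simpa using hasDerivAt_const τ a
  | add p q hp hq => simpa using! hp.add hq
  | mul_X p k hp =>
    have hX : HasDerivAt (fun τ => flowA (σ + 2 * τ) k)
        (MvPolynomial.aeval (flowA (σ + 2 * τ)) (coeffDer (MvPolynomial.X k))) τ := by
      rw [coeffDer, MvPolynomial.mkDerivation_X, map_sub, map_neg, map_smul, map_smul,
        aeval_flowA_zCoeff, aeval_flowA_v _ k.2, smul_eq_mul, smul_eq_mul]
      refine (hasDerivAt_invCoeff_flow analyticAt_eta k.1.natAbs σ τ).congr_deriv ?_
      rw [Int.abs_eq_natAbs, Int.cast_natCast]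
    simp only [map_mul, MvPolynomial.aeval_X, Derivation.leibniz, map_add, smul_eq_mul]
    refine (hp.mul hX).congr_deriv ?_
    ring

/-- On `u^n q(v)` this is the product rule: the derivative of `b_n` accounts for `𝒩₁` and `𝒴`, that
of `q(a)` for `𝒩₀` and `𝒵`. -/
lemma hasDerivAt_flow {Hp Hm : ℂ → ℂ} (hp : AnalyticAt ℂ Hp 0) (hm : AnalyticAt ℂ Hm 0)
    (σ τ : ℂ) (x : TracePoly) :
    HasDerivAt (fun τ => flow Hp Hm (σ + 2 * τ) x) (flow Hp Hm (σ + 2 * τ) (opD x)) τ := by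
  induction x using tracePoly_induction with
  | h0 => simpa using hasDerivAt_const τ (0 : ℂ)
  | hadd x y hx hy => simpa using! hx.add hy
  | hs n q =>
    have hb : HasDerivAt (fun τ => flowB Hp Hm (σ + 2 * τ) n)
        (-(((|n| : ℤ) : ℂ) * flowB Hp Hm (σ + 2 * τ) n)
          - 2 * flow Hp Hm (σ + 2 * τ) (yPow n)) τ := by
      rw [flow_yPow, Int.abs_eq_natAbs, Int.cast_natCast]
      by_cases hn : n = 0
      · simp only [flowB, hn]
        simpa using hasDerivAt_const τ (1 : ℂ)
      · simp only [flowB, if_neg hn]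
        refine hasDerivAt_invCoeff_flow ?_ n.natAbs σ τ
        split_ifs <;> assumption
    have hq := hasDerivAt_aeval_flowA σ τ q
    rw [opD_single, map_sub, map_sub, map_smul, map_smul, flow, evalFun_coeff_mul]
    simp only [evalFun_single, smul_eq_mul, flow] at hb ⊢
    refine (hb.mul hq).congr_deriv ?_
    ring

lemma iteratedDeriv_flow {Hp Hm : ℂ → ℂ} (hp : AnalyticAt ℂ Hp 0) (hm : AnalyticAt ℂ Hm 0)
    (σ : ℂ) (n : ℕ) (x : TracePoly) :
    iteratedDeriv n (fun τ => flow Hp Hm (σ + 2 * τ) x) =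
      fun τ => flow Hp Hm (σ + 2 * τ) ((opD ^ n) x) := by
  induction n with
  | zero => simp
  | succ n ih =>
    rw [iteratedDeriv_succ, ih]
    ext τ
    rw [(hasDerivAt_flow hp hm σ τ _).deriv, pow_succ', Module.End.mul_apply]

/-- The evaluation functionals intertwine the semigroup of `𝒟` with the shift of the parameter. -/
lemma flow_expApply {Hp Hm : ℂ → ℂ} (hp : AnalyticAt ℂ Hp 0) (hm : AnalyticAt ℂ Hm 0)
    (σ c : ℂ) (x : TracePoly) :
    flow Hp Hm σ (expApply (c • opD) x) = flow Hp Hm (σ + 2 * c) x := by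
  have h1 := isExpApply_opD c x (flow Hp Hm σ)
  have hd : Differentiable ℂ (fun τ => flow Hp Hm (σ + 2 * τ) x) := fun τ =>
    (hasDerivAt_flow hp hm σ τ x).differentiableAt
  -- The Taylor series of this entire function at `0` is, term by term, the exponential series of `c
  -- • opD` tested against `flow Hp Hm σ`.
  have h2 := Complex.hasSum_taylorSeries_of_entire hd 0 c
  refine h1.unique (h2.congr_fun ?_)
  intro n
  rw [iteratedDeriv_flow hp hm, smul_pow, LinearMap.smul_apply, map_smul]
  simp

lemma flow_incl (Hp Hm : ℂ → ℂ) (σ : ℂ) (f : ℂ[T;T⁻¹]) :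
    flow Hp Hm σ (incl f) = evalLaurent (flowB Hp Hm σ) f := evalFun_incl _ _ _

lemma evalLaurent_traceEval_flowB (Hp Hm : ℂ → ℂ) (s : ℝ) (x : TracePoly) :
    evalLaurent (flowB Hp Hm s) (traceEval s x) = flow Hp Hm s x := by
  rw [evalLaurent_traceEval, flow]
  congr 2
  ext k
  exact (invCoeff_eta_eq_nu k.1 k.2 s).symm

/-- Action of `ℋ_{s,t}` on the functionals `flowB`. -/
lemma evalLaurent_transformH {Hp Hm : ℂ → ℂ} (hp : AnalyticAt ℂ Hp 0) (hm : AnalyticAt ℂ Hm 0)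
    (s t : ℝ) (f : ℂ[T;T⁻¹]) :
    evalLaurent (flowB Hp Hm s) (transformH s t f) =
      evalLaurent (flowB Hp Hm ((s - t : ℝ) : ℂ)) f := by
  rw [transformH, evalLaurent_traceEval_flowB, flow_expApply hp hm, flow_incl]
  congr 2
  push_cast
  ring

/-- Action of `𝒢_{s,t}` on the functionals `flowB`. -/
lemma evalLaurent_transformG {Hp Hm : ℂ → ℂ} (hp : AnalyticAt ℂ Hp 0) (hm : AnalyticAt ℂ Hm 0)
    (s t : ℝ) (f : ℂ[T;T⁻¹]) :
    evalLaurent (flowB Hp Hm ((s - t : ℝ) : ℂ)) (transformG s t f) =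
      evalLaurent (flowB Hp Hm s) f := by
  rw [transformG, evalLaurent_traceEval_flowB, flow_expApply hp hm, flow_incl]
  congr 2
  push_cast
  ring

/-! ### Point evaluations as flow functionals -/

/-- `u f / (1 - u f)` for `f = coreMap s`. -/
def geomCore (s u w : ℂ) : ℂ := u * coreMap s w / (1 - u * coreMap s w)

lemma analyticAt_geomCore (s u : ℂ) : AnalyticAt ℂ (geomCore s u) 0 := by
  have := analyticAt_coreMap s
  unfold geomCore
  fun_prop (disch := simp)

lemma taylorCoeff_geom (u : ℂ) {n : ℕ} (hn : n ≠ 0) :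
    taylorCoeff (fun z => u * z / (1 - u * z)) n = u ^ n := by
  obtain ⟨n, rfl⟩ := Nat.exists_eq_succ_of_ne_zero hn
  have ha : AnalyticAt ℂ (fun z => u * z / (1 - u * z)) 0 := by fun_prop (disch := simp)
  have h : (fun z => u * z / (1 - u * z)) =ᶠ[𝓝 0]
      fun z => u * z ^ 1 + u * (z ^ 1 * (u * z / (1 - u * z))) := by
    have : ∀ᶠ z in 𝓝 (0 : ℂ), 1 - u * z ≠ 0 := by
      apply ContinuousAt.eventually_ne (by fun_prop)
      simp
    filter_upwards [this] with z hz
    field_simp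
    ring
  have step (n : ℕ) := taylorCoeff_congr h n
  have step' (n : ℕ) : taylorCoeff (fun z => u * z / (1 - u * z)) (n + 1) =
      (if n + 1 = 1 then u else 0) + u * taylorCoeff (fun z => u * z / (1 - u * z)) n := by
    conv_lhs => rw [step (n + 1)]
    rw [taylorCoeff_add (by fun_prop) (by fun_prop), taylorCoeff_const_mul, taylorCoeff_pow,
      taylorCoeff_const_mul, taylorCoeff_pow_mul ha,
      if_pos (show 1 ≤ n + 1 by omega), Nat.add_sub_cancel]
    simp
  clear hn
  induction n with
  | zero => rw [step']; simp [taylorCoeff_zero]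
  | succ n ih => rw [step', ih]; simp; ring

/-- At the matching parameter `coreMap s` and `coreInv s` cancel, leaving the geometric series
`uz/(1-uz)`. -/
lemma invCoeff_geomCore_self (s u : ℂ) {n : ℕ} (hn : n ≠ 0) :
    invCoeff (geomCore s u) s n = u ^ n := by
  rw [← taylorCoeff_geom u hn, invCoeff]
  apply taylorCoeff_congr
  filter_upwards [coreMap_coreInv s] with z hz
  rw [geomCore, hz]

/-- Valid at `u = 0` as well, where `0⁻¹ = 0` makes both sides vanish for `n < 0`; the generating
function needs this point. -/
lemma flowB_geomCore_self (s u : ℂ) :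
    flowB (geomCore s u) (geomCore s u⁻¹) s = fun n => u ^ n := by
  ext n
  rw [flowB]
  split_ifs with h h'
  · simp [h]
  · rw [invCoeff_geomCore_self _ _ (by omega)]
    conv_rhs => rw [← Int.natAbs_of_nonneg h'.le]
    rw [zpow_natCast]
  · rw [invCoeff_geomCore_self _ _ (by omega)]
    conv_rhs => rw [show n = -(n.natAbs : ℤ) by omega]
    rw [zpow_neg, zpow_natCast, inv_pow]

/-- `ℋ_{s,t}` evaluated at a point. -/
lemma evalAt_transformH (s t : ℝ) (f : ℂ[T;T⁻¹]) (u : ℂ) :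
    evalAt (transformH s t f) u =
      evalLaurent (flowB (geomCore s u) (geomCore s u⁻¹) ((s - t : ℝ) : ℂ)) f := by
  rw [evalAt_eq_evalLaurent, ← flowB_geomCore_self (s : ℂ) u,
    evalLaurent_transformH (analyticAt_geomCore _ _) (analyticAt_geomCore _ _)]

/-- `𝒢_{t,t}` evaluated at a point. -/
lemma evalAt_transformG_self (t : ℝ) (f : ℂ[T;T⁻¹]) (z : ℂ) :
    evalAt (transformG t t f) z =
      evalLaurent (flowB (geomCore 0 z) (geomCore 0 z⁻¹) (t : ℂ)) f := by
  rw [evalAt_eq_evalLaurent, ← flowB_geomCore_self 0 z,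
    ← evalLaurent_transformG (analyticAt_geomCore _ _) (analyticAt_geomCore _ _) t t]
  simp

/-- `𝒢_{t,t}` is a left inverse of `ℋ_{t,t}`, pointwise. -/
lemma evalAt_transformG_transformH (t : ℝ) (f : ℂ[T;T⁻¹]) (z : ℂ) :
    evalAt (transformG t t (transformH t t f)) z = evalAt f z := by
  rw [evalAt_transformG_self,
    evalLaurent_transformH (analyticAt_geomCore _ _) (analyticAt_geomCore _ _), sub_self,
    Complex.ofReal_zero, flowB_geomCore_self, evalAt_eq_evalLaurent]

/-! ### The images of the powers of `u` are polynomials -/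

lemma evalFun_eq_zero_of_mem_nonnegPart {b : ℤ → ℂ} (hb : ∀ n, 0 ≤ n → b n = 0)
    (a : TraceIdx → ℂ) {x : TracePoly} (hx : x ∈ nonnegPart) : evalFun b a x = 0 := by
  have : nonnegPart ≤ LinearMap.ker (evalFun b a) := by
    refine Submodule.span_le.2 ?_
    rintro _ ⟨n, q, hn, rfl⟩
    rw [SetLike.mem_coe, LinearMap.mem_ker, evalFun_single, hb n hn, zero_mul]
  exact this hx

/-- Extracting the coefficient of `u^m` after `π_s` is a linear functional that vanishes on
`nonnegPart`, hence on every term of the exponential series. -/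
lemma coeff_transformH_T_of_neg (s t : ℝ) (k : ℕ) {m : ℤ} (hm : m < 0) :
    (transformH s t (LaurentPolynomial.T (k : ℤ))).coeff m = 0 := by
  have h1 : (transformH s t (LaurentPolynomial.T (k : ℤ))).coeff m =
      evalLaurent (fun n => if n = m then 1 else 0)
        (transformH s t (LaurentPolynomial.T (k : ℤ))) := by
    simp [evalLaurent]
  rw [h1, transformH, evalLaurent_traceEval]
  refine (isExpApply_opD _ _ _).unique (hasSum_zero.congr_fun ?_)
  intro n
  have hmem : ∀ n : ℕ, (((-(t / 2) : ℝ) : ℂ) • opD) ^ n • incl (LaurentPolynomial.T (k : ℤ))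
      ∈ nonnegPart := by
    intro n
    induction n with
    | zero =>
      have : incl (LaurentPolynomial.T (k : ℤ)) = AddMonoidAlgebra.single (k : ℤ) (1 : VPoly) := by
        rw [incl, LaurentPolynomial.T, AddMonoidAlgebra.mapRingHom_single, map_one]
      rw [pow_zero, one_smul, this]
      exact single_mem_nonnegPart (by omega) _
    | succ n ih =>
      rw [pow_succ', mul_smul]
      exact Submodule.smul_mem _ _ (opD_mem_nonnegPart ih)
  have := evalFun_eq_zero_of_mem_nonnegPart (b := fun n => if n = m then 1 else 0)
    (fun n hn => if_neg (by omega)) (fun k : TraceIdx => ((nu k.1 s : ℝ) : ℂ)) (hmem n)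
  rw [← Module.End.smul_def, this, mul_zero]

lemma exists_toLaurent_eq {f : ℂ[T;T⁻¹]} (hf : ∀ m < 0, f.coeff m = 0) :
    ∃ p : Polynomial ℂ, f = Polynomial.toLaurent p := by
  refine ⟨LaurentPolynomial.trunc f, ?_⟩
  suffices h : ∀ s : Finset ℤ, (∀ m ∈ s, 0 ≤ m) →
      (Polynomial.toLaurent (LaurentPolynomial.trunc
        (∑ m ∈ s, AddMonoidAlgebra.single m (f.coeff m))) : ℂ[T;T⁻¹]) =
        ∑ m ∈ s, AddMonoidAlgebra.single m (f.coeff m) by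
    have h2 : f = ∑ m ∈ f.coeff.support, AddMonoidAlgebra.single m (f.coeff m) :=
      (AddMonoidAlgebra.sum_coeff_single f).symm
    have := h f.coeff.support fun m hm => by
      by_contra hneg
      exact Finsupp.mem_support_iff.1 hm (hf m (by omega))
    rw [← h2] at this
    exact this.symm
  intro s hs
  rw [map_sum, map_sum]
  refine Finset.sum_congr rfl fun m hm => ?_
  rw [LaurentPolynomial.single_eq_C_mul_T, LaurentPolynomial.trunc_C_mul_T, if_pos (hs m hm),
    ← Polynomial.C_mul_X_pow_eq_monomial, Polynomial.toLaurent_C_mul_X_pow,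
    Int.toNat_of_nonneg (hs m hm)]

/-! ### The generating function -/

lemma evalLaurent_T (b : ℤ → ℂ) (n : ℤ) : evalLaurent b (LaurentPolynomial.T n) = b n := by
  rw [LaurentPolynomial.T, evalLaurent_single, one_mul]

lemma mul_expCayley (a : ℝ) (z : ℂ) : z * expCayley a z = coreMap a z := rfl

lemma genTerm_succ (s t : ℝ) (u z : ℂ) (k : ℕ) :
    genTerm s t u z (k + 1) =
      taylorCoeff (fun z => geomCore s u (coreInv ((s - t : ℝ) : ℂ) z)) (k + 1) * z ^ (k + 1) := by
  rw [genTerm, evalAt_transformH, evalLaurent_T, flowB, if_neg (by omega), if_pos (by omega)]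
  rfl

/-- On a small disc `|f_s(χ_{s-t}(z))| < 1`, so for all `|u| < 1` at once the denominator has no
zero and the Taylor series converges on that disc. -/
lemma exists_hasSum_genTerm (s t : ℝ) : ∃ r : ℝ, 0 < r ∧ r < 1 ∧ ∀ u z : ℂ, ‖u‖ < r → ‖z‖ < r →
    HasSum (fun k : ℕ => genTerm s t u z (k + 1))
      (geomCore s u (coreInv ((s - t : ℝ) : ℂ) z)) := by
  set σ : ℂ := ((s - t : ℝ) : ℂ)
  have ha : AnalyticAt ℂ (fun z => coreMap s (coreInv σ z)) 0 :=
    analyticAt_comp_coreInv (analyticAt_coreMap s) σ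
  have hb : ∀ᶠ z in 𝓝 (0 : ℂ), ‖coreMap s (coreInv σ z)‖ < 1 := by
    have : Tendsto (fun z => ‖coreMap s (coreInv σ z)‖) (𝓝 0) (𝓝 0) := by
      simpa using ((tendsto_coreMap s).comp (tendsto_coreInv σ)).norm
    exact this.eventually (gt_mem_nhds one_pos)
  obtain ⟨r, hr, h⟩ := Metric.eventually_nhds_iff_ball.1 (ha.eventually_analyticAt.and hb)
  refine ⟨min r (1 / 2), by positivity, (min_le_right _ _).trans_lt (by norm_num),
    fun u z hu hz => ?_⟩
  have hu1 : ‖u‖ < 1 := hu.trans_le ((min_le_right _ _).trans (by norm_num))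
  have hzr : z ∈ Metric.ball (0 : ℂ) r := by
    rw [mem_ball_zero_iff]; exact hz.trans_le (min_le_left _ _)
  have hd : DifferentiableOn ℂ (fun z => geomCore s u (coreInv σ z)) (Metric.ball 0 r) := by
    intro w hw
    obtain ⟨h1, h2⟩ := h w hw
    have h3 : 1 - u * coreMap s (coreInv σ w) ≠ 0 := by
      intro h0
      have : ‖u * coreMap s (coreInv σ w)‖ = 1 := by rw [← sub_eq_zero.1 h0, norm_one]
      rw [norm_mul] at this
      nlinarith [norm_nonneg u, norm_nonneg (coreMap s (coreInv σ w))]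
    have h4 : DifferentiableAt ℂ (fun z => u * coreMap s (coreInv σ z)) w :=
      h1.differentiableAt.const_mul u
    exact (h4.fun_div (h4.const_sub 1) h3).differentiableWithinAt
  have hs := hasSum_taylorCoeff hd hzr
  -- The series starts at `k = 1`; the constant term is zero because `geomCore` vanishes at `0`.
  rw [← hasSum_nat_add_iff' 1] at hs
  have h0 : ∑ i ∈ Finset.range 1,
      taylorCoeff (fun z => geomCore s u (coreInv σ z)) i * z ^ i = 0 := by
    simp [taylorCoeff_zero, geomCore]
  rw [h0, sub_zero] at hs
  exact hs.congr_fun fun k => genTerm_succ s t u z k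

lemma genFun_eq_geomCore (s t : ℝ) : ∃ r : ℝ, 0 < r ∧ r < 1 ∧ ∀ u z : ℂ, ‖u‖ < r → ‖z‖ < r →
    genFun s t u z = geomCore s u (coreInv ((s - t : ℝ) : ℂ) z) := by
  obtain ⟨r, hr, hr1, h⟩ := exists_hasSum_genTerm s t
  exact ⟨r, hr, hr1, fun u z hu hz => (h u z hu hz).tsum_eq⟩

lemma geomCore_eq (s : ℝ) (u z : ℂ) (h : 1 - u * z * expCayley s z ≠ 0) :
    geomCore s u z = (1 - u * z * expCayley s z)⁻¹ - 1 := by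
  rw [mul_assoc, mul_expCayley] at *
  rw [geomCore]
  field_simp
  ring

lemma eventually_one_sub_ne_zero (s : ℝ) : ∀ᶠ z in 𝓝 (0 : ℂ), ∀ u : ℂ, ‖u‖ < 1 →
    1 - u * z * expCayley s z ≠ 0 := by
  have : Tendsto (fun z => ‖coreMap s z‖) (𝓝 0) (𝓝 0) := by
    simpa using (tendsto_coreMap s).norm
  filter_upwards [this.eventually (gt_mem_nhds one_pos)] with z hz u hu h0
  rw [mul_assoc, mul_expCayley] at h0
  have : ‖u * coreMap s z‖ = 1 := by rw [← sub_eq_zero.1 h0, norm_one]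
  rw [norm_mul] at this
  nlinarith [norm_nonneg u, norm_nonneg (coreMap s z)]

lemma genFun_implicit (s t : ℝ) : ∃ r : ℝ, 0 < r ∧ r < 1 ∧ ∀ u z : ℂ, ‖u‖ < r → ‖z‖ < r →
    1 - u * z * expCayley s z ≠ 0 ∧
    (Summable fun k : ℕ => genTerm s t u (z * expCayley (s - t) z) (k + 1)) ∧
    genFun s t u (z * expCayley (s - t) z) = (1 - u * z * expCayley s z)⁻¹ - 1 := by
  obtain ⟨r, hr, hr1, h⟩ := exists_hasSum_genTerm s t
  have h1 : ∀ᶠ z in 𝓝 (0 : ℂ), coreMap ((s - t : ℝ) : ℂ) z ∈ Metric.ball (0 : ℂ) r :=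
    (tendsto_coreMap _).eventually (Metric.ball_mem_nhds 0 hr)
  obtain ⟨ρ, hρ, h2⟩ := Metric.eventually_nhds_iff_ball.1
    (h1.and ((coreInv_coreMap ((s - t : ℝ) : ℂ)).and (eventually_one_sub_ne_zero s)))
  refine ⟨min r ρ, by positivity, (min_le_left _ _).trans_lt hr1, fun u z hu hz => ?_⟩
  obtain ⟨h3, h4, h5⟩ := h2 z (mem_ball_zero_iff.2 (hz.trans_le (min_le_right _ _)))
  have hu' : ‖u‖ < r := hu.trans_le (min_le_left _ _)
  have h6 := h u (coreMap ((s - t : ℝ) : ℂ) z) hu' (mem_ball_zero_iff.1 h3)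
  have h7 := h5 u (hu'.trans hr1)
  refine ⟨h7, h6.summable, ?_⟩
  rw [mul_expCayley, genFun, h6.tsum_eq, h4, geomCore_eq s u z h7]

/-- No regularity of `F` enters: every small `z` equals `coreMap (s - t) w` with the small `w =
coreInv (s - t) z`. -/
lemma genFun_unique (s t : ℝ) (F : ℂ → ℂ → ℂ)
    (hF : ∃ r : ℝ, 0 < r ∧ ∀ u z : ℂ, ‖u‖ < r → ‖z‖ < r →
      F u (z * expCayley (s - t) z) = (1 - u * z * expCayley s z)⁻¹ - 1) :
    ∃ r : ℝ, 0 < r ∧ ∀ u z : ℂ, ‖u‖ < r → ‖z‖ < r → F u z = genFun s t u z := by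
  obtain ⟨r, hr, hF⟩ := hF
  obtain ⟨r', hr', -, h⟩ := genFun_eq_geomCore s t
  have h1 : ∀ᶠ z in 𝓝 (0 : ℂ), coreInv ((s - t : ℝ) : ℂ) z ∈ Metric.ball (0 : ℂ) r :=
    (tendsto_coreInv _).eventually (Metric.ball_mem_nhds 0 hr)
  obtain ⟨ρ, hρ, h2⟩ := Metric.eventually_nhds_iff_ball.1
    (h1.and ((coreMap_coreInv ((s - t : ℝ) : ℂ)).and
      ((tendsto_coreInv ((s - t : ℝ) : ℂ)).eventually (eventually_one_sub_ne_zero s))))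
  refine ⟨min (min r r') (min ρ 1), by positivity, fun u z hu hz => ?_⟩
  simp only [lt_min_iff] at hu hz
  obtain ⟨h3, h4, h5⟩ := h2 z (mem_ball_zero_iff.2 hz.2.1)
  have := hF u (coreInv ((s - t : ℝ) : ℂ) z) hu.1.1 (mem_ball_zero_iff.1 h3)
  rw [mul_expCayley, h4] at this
  rw [this, h u z hu.1.2 hz.1.2, geomCore_eq _ _ _ (h5 u hu.2.2)]

/-! ### The inverse map on the closed unit disc -/

lemma re_cayley (w : ℂ) : ((1 + w) / (1 - w)).re = (1 - ‖w‖ ^ 2) / ‖1 - w‖ ^ 2 := by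
  rw [Complex.div_re, ← Complex.normSq_eq_norm_sq, ← Complex.normSq_eq_norm_sq, ← add_div]
  congr 1
  simp [Complex.normSq_apply]
  ring

lemma norm_coreMap (t : ℝ) (w : ℂ) :
    ‖coreMap t w‖ = ‖w‖ * Real.exp (t / 2 * ((1 - ‖w‖ ^ 2) / ‖1 - w‖ ^ 2)) := by
  rw [coreMap, norm_mul, Complex.norm_exp, ← re_cayley]
  congr 2
  have : (t : ℂ) / 2 = ((t / 2 : ℝ) : ℂ) := by push_cast; rfl
  rw [this, Complex.re_ofReal_mul]

lemma norm_corePhi (t : ℝ) (w : ℂ) :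
    ‖corePhi t w‖ = Real.exp (-(t / 2 * ((1 - ‖w‖ ^ 2) / ‖1 - w‖ ^ 2))) := by
  rw [corePhi, Complex.norm_exp, ← re_cayley]
  congr 1
  have : (t : ℂ) / 2 = ((t / 2 : ℝ) : ℂ) := by push_cast; rfl
  rw [Complex.neg_re, this, Complex.re_ofReal_mul]

lemma norm_corePhi_le_one {t : ℝ} (ht : 0 < t) {w : ℂ} (hw : ‖w‖ < 1) : ‖corePhi t w‖ ≤ 1 := by
  rw [norm_corePhi, Real.exp_le_one_iff, neg_nonpos]
  have : 0 ≤ 1 - ‖w‖ ^ 2 := by nlinarith [norm_nonneg w]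
  positivity

lemma ne_one_of_norm_lt {w : ℂ} (hw : ‖w‖ < 1) : w ≠ 1 := by
  rintro rfl
  simp at hw

lemma differentiableAt_corePhi (σ : ℂ) {w : ℂ} (hw : w ≠ 1) : DifferentiableAt ℂ (corePhi σ) w := by
  have : 1 - w ≠ 0 := sub_ne_zero.2 hw.symm
  unfold corePhi
  fun_prop (disch := assumption)

lemma analyticAt_coreMap_of_ne_one (σ : ℂ) {w : ℂ} (hw : w ≠ 1) : AnalyticAt ℂ (coreMap σ) w := by
  have : 1 - w ≠ 0 := sub_ne_zero.2 hw.symm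
  unfold coreMap
  fun_prop (disch := assumption)

/-! ### Fixed point iteration in the open disc -/

/-- The approximations of the inverse map by fixed point iteration. -/
def chiIter (t : ℝ) : ℕ → ℂ → ℂ
  | 0 => fun _ => 0
  | n + 1 => fun ζ => ζ * corePhi t (chiIter t n ζ)

lemma norm_chiIter_le {t : ℝ} (ht : 0 < t) (n : ℕ) {ζ : ℂ} (hζ : ‖ζ‖ < 1) :
    ‖chiIter t n ζ‖ ≤ ‖ζ‖ := by
  induction n with
  | zero => simp [chiIter]
  | succ n ih =>
    rw [chiIter, norm_mul]
    exact mul_le_of_le_one_right (norm_nonneg _) (norm_corePhi_le_one ht (ih.trans_lt hζ))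

lemma differentiableOn_chiIter {t : ℝ} (ht : 0 < t) (n : ℕ) :
    DifferentiableOn ℂ (chiIter t n) (Metric.ball 0 1) := by
  induction n with
  | zero => exact differentiableOn_const _
  | succ n ih =>
    intro ζ hζ
    rw [mem_ball_zero_iff] at hζ
    have h1 : chiIter t n ζ ≠ 1 := ne_one_of_norm_lt ((norm_chiIter_le ht n hζ).trans_lt hζ)
    exact differentiableWithinAt_id.mul
      ((differentiableAt_corePhi t h1).comp_differentiableWithinAt ζ
        (ih ζ (mem_ball_zero_iff.2 hζ)))

lemma chiIter_apply_zero (t : ℝ) (n : ℕ) : chiIter t n 0 = 0 := by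
  cases n <;> simp [chiIter]

lemma tendsto_chiIter {t : ℝ} (ht : 0 < t) (n : ℕ) : Tendsto (chiIter t n) (𝓝 0) (𝓝 0) := by
  have := ((differentiableOn_chiIter ht n).continuousOn.continuousAt
    (Metric.ball_mem_nhds 0 one_pos)).tendsto
  rwa [chiIter_apply_zero] at this

/-- Each step gains one order of vanishing, from the factor `ζ` and the Lipschitz bound for
`corePhi` near `0`. -/
lemma chiIter_succ_sub_isBigO {t : ℝ} (ht : 0 < t) (n : ℕ) :
    (fun ζ => chiIter t (n + 1) ζ - chiIter t n ζ) =O[𝓝 0] fun ζ => ζ ^ (n + 1) := by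
  induction n with
  | zero =>
    have h : (fun ζ : ℂ => chiIter t 1 ζ - chiIter t 0 ζ) = fun ζ => corePhi t 0 * ζ ^ 1 := by
      ext ζ
      simp [chiIter, mul_comm]
    rw [h]
    exact Asymptotics.isBigO_const_mul_self _ _ _
  | succ n ih =>
    have h1 := (analyticAt_corePhi t).hasStrictDerivAt.isBigO_sub
    have h2 : Tendsto (fun ζ => (chiIter t (n + 1) ζ, chiIter t n ζ)) (𝓝 0) (𝓝 ((0 : ℂ), (0 : ℂ))) :=
      (tendsto_chiIter ht (n + 1)).prodMk_nhds (tendsto_chiIter ht n)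
    have h3 := (h1.comp_tendsto h2).trans ih
    have h4 := (Asymptotics.isBigO_refl (fun ζ : ℂ => ζ) (𝓝 0)).mul h3
    refine h4.congr (fun ζ => ?_) (fun ζ => ?_)
    · simp [chiIter, mul_sub]
    · ring

/-- Higher order Schwarz lemma: the difference is bounded by `2` and vanishes to order `n + 1`.
Convergence thus holds on the whole disc, without any contraction estimate. -/
lemma norm_chiIter_succ_sub_le {t : ℝ} (ht : 0 < t) (n : ℕ) {ζ : ℂ} (hζ : ‖ζ‖ < 1) :
    ‖chiIter t (n + 1) ζ - chiIter t n ζ‖ ≤ 2 * ‖ζ‖ ^ (n + 1) := by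
  have h0 : chiIter t (n + 1) 0 - chiIter t n 0 = 0 := by simp [chiIter_apply_zero]
  have h := Complex.dist_le_mul_div_pow_of_mapsTo_ball_of_isLittleO
    (f := fun ζ => chiIter t (n + 1) ζ - chiIter t n ζ) (c := 0) (z := ζ) (R₁ := 1) (R₂ := 2)
    (n := n) ((differentiableOn_chiIter ht (n + 1)).sub (differentiableOn_chiIter ht n)) ?_ ?_
    (mem_ball_zero_iff.2 hζ)
  · simpa [h0] using h
  · intro w hw
    rw [mem_ball_zero_iff] at hw
    rw [h0, mem_closedBall_zero_iff]
    have h1 := norm_chiIter_le ht (n + 1) hw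
    have h2 := norm_chiIter_le ht n hw
    have := norm_sub_le (chiIter t (n + 1) w) (chiIter t n w)
    linarith
  · simp only [h0, sub_zero]
    refine (chiIter_succ_sub_isBigO ht n).trans_isLittleO ?_
    have := (Asymptotics.isLittleO_pow_pow (𝕜 := ℂ) (Nat.lt_succ_self n)).norm_right
    simpa using this

/-- The inverse map on the open unit disc. -/
def chiDisc (t : ℝ) (ζ : ℂ) : ℂ := ∑' n : ℕ, (chiIter t (n + 1) ζ - chiIter t n ζ)

lemma tendsto_chiIter_chiDisc {t : ℝ} (ht : 0 < t) {ζ : ℂ} (hζ : ‖ζ‖ < 1) :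
    Tendsto (fun n => chiIter t n ζ) atTop (𝓝 (chiDisc t ζ)) := by
  have hs : Summable fun n : ℕ => chiIter t (n + 1) ζ - chiIter t n ζ := by
    refine Summable.of_norm_bounded (g := fun n => 2 * ‖ζ‖ ^ (n + 1)) ?_
      fun n => norm_chiIter_succ_sub_le ht n hζ
    exact ((summable_nat_add_iff 1).2
      (summable_geometric_of_lt_one (norm_nonneg _) hζ)).mul_left 2
  refine hs.hasSum.tendsto_sum_nat.congr fun n => ?_
  rw [Finset.sum_range_sub (fun n => chiIter t n ζ)]
  simp [chiIter]

lemma differentiableOn_chiDisc {t : ℝ} (ht : 0 < t) :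
    DifferentiableOn ℂ (chiDisc t) (Metric.ball 0 1) := by
  intro ζ hζ
  rw [mem_ball_zero_iff] at hζ
  obtain ⟨ρ, h1, h2⟩ := exists_between hζ
  have h0 : 0 ≤ ρ := (norm_nonneg ζ).trans h1.le
  have hd : DifferentiableOn ℂ (chiDisc t) (Metric.ball 0 ρ) := by
    refine Complex.differentiableOn_tsum_of_summable_norm (u := fun n => 2 * ρ ^ (n + 1)) ?_ ?_
      Metric.isOpen_ball ?_
    · exact ((summable_nat_add_iff 1).2 (summable_geometric_of_lt_one h0 h2)).mul_left 2
    · intro n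
      exact ((differentiableOn_chiIter ht (n + 1)).sub (differentiableOn_chiIter ht n)).mono
        (Metric.ball_subset_ball h2.le)
    · intro n w hw
      rw [mem_ball_zero_iff] at hw
      refine (norm_chiIter_succ_sub_le ht n (hw.trans h2)).trans ?_
      gcongr
  exact (hd.differentiableAt (Metric.isOpen_ball.mem_nhds (mem_ball_zero_iff.2 h1))).differentiableWithinAt

lemma norm_chiDisc_le {t : ℝ} (ht : 0 < t) {ζ : ℂ} (hζ : ‖ζ‖ < 1) : ‖chiDisc t ζ‖ ≤ ‖ζ‖ :=
  le_of_tendsto (tendsto_chiIter_chiDisc ht hζ).norm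
    (Eventually.of_forall fun n => norm_chiIter_le ht n hζ)

lemma coreMap_chiDisc {t : ℝ} (ht : 0 < t) {ζ : ℂ} (hζ : ‖ζ‖ < 1) :
    coreMap t (chiDisc t ζ) = ζ := by
  have h1 := tendsto_chiIter_chiDisc ht hζ
  have hne : chiDisc t ζ ≠ 1 := ne_one_of_norm_lt ((norm_chiDisc_le ht hζ).trans_lt hζ)
  have h2 : Tendsto (fun n => chiIter t (n + 1) ζ) atTop (𝓝 (ζ * corePhi t (chiDisc t ζ))) :=
    ((differentiableAt_corePhi t hne).continuousAt.tendsto.comp h1).const_mul ζ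
  have h3 := tendsto_nhds_unique ((tendsto_add_atTop_iff_nat 1).2 h1) h2
  have h4 := coreMap_mul_corePhi t (chiDisc t ζ)
  rw [h3, ← h3] at h4
  have h5 : corePhi t (chiDisc t ζ) ≠ 0 := Complex.exp_ne_zero _
  exact mul_right_cancel₀ h5 (h4.trans h3)

/-! ### Extension of the inverse map to the circle -/

/-- A compact part of the closed unit disc which avoids `1` and contains the range of the inverse
map. -/
def chiRange (t : ℝ) : Set ℂ := {w | ‖w‖ ≤ 1 ∧ t / 2 * ‖w‖ ≤ ‖1 - w‖ ^ 2}

lemma isClosed_chiRange (t : ℝ) : IsClosed (chiRange t) := by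
  have h1 : IsClosed {w : ℂ | ‖w‖ ≤ 1} := isClosed_le (by fun_prop) (by fun_prop)
  have h2 : IsClosed {w : ℂ | t / 2 * ‖w‖ ≤ ‖1 - w‖ ^ 2} := isClosed_le (by fun_prop) (by fun_prop)
  exact h1.inter h2

lemma isCompact_chiRange (t : ℝ) : IsCompact (chiRange t) :=
  (isCompact_closedBall (0 : ℂ) 1).of_isClosed_subset (isClosed_chiRange t)
    fun _ hw => mem_closedBall_zero_iff.2 hw.1

lemma ne_one_of_mem_chiRange {t : ℝ} (ht : 0 < t) {w : ℂ} (hw : w ∈ chiRange t) : w ≠ 1 := by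
  rintro rfl
  have := hw.2
  simp at this
  linarith

/-- Inserting `exp x ≥ 1 + x` into `|f_t(w)| < 1` and cancelling `1 - |w| > 0` gives `(t/2) |w| (1 +
|w|) < |1 - w|²`. This keeps `w` away from the essential singularity `1`. -/
lemma mem_chiRange {t : ℝ} (ht : 0 < t) {w : ℂ} (hw : ‖w‖ < 1) (h : ‖coreMap t w‖ < 1) :
    w ∈ chiRange t := by
  refine ⟨hw.le, ?_⟩
  rw [norm_coreMap] at h
  have h1 : 0 < ‖1 - w‖ := norm_pos_iff.2 (sub_ne_zero.2 (ne_one_of_norm_lt hw).symm)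
  have h2 := Real.add_one_le_exp (t / 2 * ((1 - ‖w‖ ^ 2) / ‖1 - w‖ ^ 2))
  have h3 : ‖w‖ * (t / 2 * ((1 - ‖w‖ ^ 2) / ‖1 - w‖ ^ 2) + 1) < 1 :=
    (mul_le_mul_of_nonneg_left h2 (norm_nonneg w)).trans_lt h
  have h4 : t / 2 * ‖w‖ * (1 - ‖w‖ ^ 2) / ‖1 - w‖ ^ 2 < 1 - ‖w‖ := by
    calc _ = ‖w‖ * (t / 2 * ((1 - ‖w‖ ^ 2) / ‖1 - w‖ ^ 2) + 1) - ‖w‖ := by ring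
      _ < 1 - ‖w‖ := by linarith
  rw [div_lt_iff₀ (by positivity)] at h4
  have h5 : 0 < 1 - ‖w‖ := by linarith
  have h6 : t / 2 * ‖w‖ * (1 + ‖w‖) < ‖1 - w‖ ^ 2 := by
    refine lt_of_mul_lt_mul_left ?_ h5.le
    nlinarith
  have : 0 ≤ t / 2 * ‖w‖ * ‖w‖ := by positivity
  nlinarith

lemma chiDisc_mem_chiRange {t : ℝ} (ht : 0 < t) {ζ : ℂ} (hζ : ‖ζ‖ < 1) :
    chiDisc t ζ ∈ chiRange t :=
  mem_chiRange ht ((norm_chiDisc_le ht hζ).trans_lt hζ) (by rwa [coreMap_chiDisc ht hζ])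

/-- An infinite fibre would accumulate at a point other than `1`, and the identity theorem on `ℂ \
{1}` would make `coreMap t` constantly `ζ₀`, against its value `0` at `0`. -/
lemma finite_fiber_coreMap {t : ℝ} (ht : 0 < t) {ζ₀ : ℂ} (h0 : ζ₀ ≠ 0) :
    {w ∈ chiRange t | coreMap t w = ζ₀}.Finite := by
  by_contra hinf
  obtain ⟨x, hx, hacc⟩ := Set.Infinite.exists_accPt_of_subset_isCompact hinf
    (isCompact_chiRange t) fun w hw => hw.1
  have hfreq : ∃ᶠ w in 𝓝[≠] x, coreMap t w = ζ₀ :=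
    (accPt_iff_frequently_nhdsNE.1 hacc).mono fun w hw => hw.2
  have ha : AnalyticOnNhd ℂ (coreMap t) {1}ᶜ := fun w hw => analyticAt_coreMap_of_ne_one t hw
  have hc : IsPreconnected ({1}ᶜ : Set ℂ) :=
    (isConnected_compl_singleton_of_one_lt_rank (by simp [Complex.rank_real_complex]) 1).isPreconnected
  have := ha.eqOn_of_preconnected_of_frequently_eq (analyticOnNhd_const (v := ζ₀)) hc
    (ne_one_of_mem_chiRange ht hx) hfreq
  have h1 := this (show (0 : ℂ) ∈ ({1}ᶜ : Set ℂ) by simp)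
  simp at h1
  exact h0 h1.symm

/-- The boundary limits of the inverse map exist: the cluster set at a boundary point is connected
and is contained in a finite set. -/
lemma exists_tendsto_chiDisc {t : ℝ} (ht : 0 < t) {ζ₀ : ℂ} (h0 : ‖ζ₀‖ = 1) :
    ∃ y, Tendsto (chiDisc t) (𝓝[Metric.ball 0 1] ζ₀) (𝓝 y) := by
  have hne : ζ₀ ≠ 0 := by rintro rfl; simp at h0
  set l := 𝓝[Metric.ball (0 : ℂ) 1] ζ₀
  have hl : l.NeBot := by
    rw [← mem_closure_iff_nhdsWithin_neBot, closure_ball _ one_ne_zero, mem_closedBall_zero_iff]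
    exact h0.le
  have hball : ∀ᶠ ζ in l, ‖ζ‖ < 1 := by
    filter_upwards [self_mem_nhdsWithin] with ζ hζ using mem_ball_zero_iff.1 hζ
  have hK : ∀ᶠ ζ in l, chiDisc t ζ ∈ chiRange t := hball.mono fun ζ hζ => chiDisc_mem_chiRange ht hζ
  have hlim : Tendsto (fun ζ => coreMap t (chiDisc t ζ)) l (𝓝 ζ₀) := by
    have : Tendsto (fun ζ : ℂ => ζ) l (𝓝 ζ₀) := nhdsWithin_le_nhds
    exact this.congr' (hball.mono fun ζ hζ => (coreMap_chiDisc ht hζ).symm)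
  have hclus : ∀ y ∈ chiRange t, MapClusterPt y l (chiDisc t) → coreMap t y = ζ₀ := by
    intro y hy hcl
    have h1 : MapClusterPt (coreMap t y) l (coreMap t ∘ chiDisc t) :=
      hcl.continuousAt_comp
        (analyticAt_coreMap_of_ne_one t (ne_one_of_mem_chiRange ht hy)).continuousAt
    have h2 : ClusterPt (coreMap t y) (𝓝 ζ₀) := ClusterPt.mono h1 hlim
    exact eq_of_nhds_neBot h2
  obtain ⟨y, hy, hcl⟩ := (isCompact_chiRange t).exists_mapClusterPt_of_frequently hK.frequently
  refine ⟨y, Metric.nhds_basis_ball.tendsto_right_iff.2 fun ε hε => ?_⟩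
  have hfin : ({w ∈ chiRange t | coreMap t w = ζ₀} \ {y}).Finite :=
    (finite_fiber_coreMap ht hne).subset Set.sdiff_subset
  obtain ⟨δ, hδ, hδS⟩ := Metric.mem_nhds_iff.1
    (hfin.isClosed.isOpen_compl.mem_nhds (show y ∈ _ from fun h => h.2 rfl))
  set ρ := min ε (δ / 2)
  have hρ : 0 < ρ := by positivity
  -- Otherwise there would be a cluster point at distance `ρ` from `y`; it would lie in the fibre
  -- over `ζ₀`, while `ρ < δ` excludes every fibre point but `y`.
  have hsphere : ∀ᶠ ζ in l, dist (chiDisc t ζ) y ≠ ρ := by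
    by_contra hcon
    have hfr : ∃ᶠ ζ in l, chiDisc t ζ ∈ chiRange t ∩ Metric.sphere y ρ := by
      rw [not_eventually] at hcon
      exact (hcon.and_eventually hK).mono fun ζ hζ => ⟨hζ.2, not_ne_iff.1 hζ.1⟩
    obtain ⟨y', hy', hcl'⟩ := ((isCompact_chiRange t).inter_right
      Metric.isClosed_sphere).exists_mapClusterPt_of_frequently hfr
    have hd : dist y' y = ρ := hy'.2
    refine hδS (show y' ∈ Metric.ball y δ from ?_) ⟨⟨hy'.1, hclus y' hy'.1 hcl'⟩, ?_⟩
    · rw [Metric.mem_ball, hd]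
      exact (min_le_right _ _).trans_lt (by linarith)
    · rintro rfl
      rw [dist_self] at hd
      exact hρ.ne hd
  obtain ⟨r, hr, hr'⟩ := Metric.mem_nhdsWithin_iff.1 hsphere
  set U : Set ℂ := Metric.ball ζ₀ r ∩ Metric.ball 0 1
  have hU : IsPreconnected U :=
    ((convex_ball ζ₀ r).inter (convex_ball 0 1)).isPreconnected
  have hUl : U ∈ l := Filter.inter_mem (mem_nhdsWithin_of_mem_nhds (Metric.ball_mem_nhds _ hr))
    self_mem_nhdsWithin
  have hcont : ContinuousOn (fun ζ => dist (chiDisc t ζ) y) U :=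
    (continuous_id.dist continuous_const).comp_continuousOn
      ((differentiableOn_chiDisc ht).continuousOn.mono Set.inter_subset_right)
  -- Some value is within `ρ` of `y`, and on the connected set `U` the distance cannot cross `ρ`, so
  -- all values on `U` are trapped.
  have hfr : ∃ᶠ ζ in l, chiDisc t ζ ∈ Metric.ball y ρ :=
    hcl.frequently (Metric.ball_mem_nhds y hρ)
  obtain ⟨ζ₁, hζ₁, hζ₁U⟩ := (hfr.and_eventually hUl).exists
  filter_upwards [hUl] with ζ hζ
  have : dist (chiDisc t ζ) y < ρ := by
    by_contra hge
    obtain ⟨ζ₂, hζ₂, h2⟩ := hU.intermediate_value hζ₁U hζ hcont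
      (⟨(Metric.mem_ball.1 hζ₁).le, not_lt.1 hge⟩ : ρ ∈ Set.Icc _ _)
    exact hr' hζ₂ h2
  exact Metric.mem_ball.2 (this.trans_le (min_le_left _ _))

lemma exists_isInverseMap {t : ℝ} (ht : 0 < t) : ∃ χ, IsInverseMap t χ := by
  have hlim : ∀ ζ ∈ Metric.closedBall (0 : ℂ) 1,
      ∃ y, Tendsto (chiDisc t) (𝓝[Metric.ball 0 1] ζ) (𝓝 y) := by
    intro ζ hζ
    rw [mem_closedBall_zero_iff] at hζ
    rcases hζ.lt_or_eq with h | h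
    · exact ⟨_, (differentiableOn_chiDisc ht).continuousOn ζ (mem_ball_zero_iff.2 h)⟩
    · exact exists_tendsto_chiDisc ht h
  have hcl : closure (Metric.ball (0 : ℂ) 1) = Metric.closedBall 0 1 := closure_ball _ one_ne_zero
  have hext : ∀ ζ ∈ Metric.ball (0 : ℂ) 1,
      extendFrom (Metric.ball 0 1) (chiDisc t) ζ = chiDisc t ζ :=
    extendFrom_extends (differentiableOn_chiDisc ht).continuousOn
  have hnb : ∀ ζ ∈ Metric.closedBall (0 : ℂ) 1, (𝓝[Metric.ball 0 1] ζ).NeBot := fun ζ hζ =>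
    mem_closure_iff_nhdsWithin_neBot.1 (hcl ▸ hζ)
  have hmem : ∀ ζ ∈ Metric.closedBall (0 : ℂ) 1,
      extendFrom (Metric.ball 0 1) (chiDisc t) ζ ∈ chiRange t := by
    intro ζ hζ
    have := hnb ζ hζ
    refine (isClosed_chiRange t).mem_of_tendsto (tendsto_extendFrom (hlim ζ hζ)) ?_
    filter_upwards [self_mem_nhdsWithin] with w hw
    exact chiDisc_mem_chiRange ht (mem_ball_zero_iff.1 hw)
  refine ⟨extendFrom (Metric.ball 0 1) (chiDisc t), ?_, ?_, ?_, ?_, ?_⟩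
  · exact continuousOn_extendFrom hcl.ge hlim
  · exact (differentiableOn_chiDisc ht).congr hext
  · rw [hext 0 (by simp), ← norm_le_zero_iff]
    simpa using norm_chiDisc_le ht (ζ := 0) (by simp)
  · exact fun ζ hζ => ne_one_of_mem_chiRange ht (hmem ζ hζ)
  · intro ζ hζ
    have := hnb ζ hζ
    rw [mul_expCayley]
    have h1 : Tendsto (fun w => coreMap t (chiDisc t w)) (𝓝[Metric.ball 0 1] ζ)
        (𝓝 (coreMap t (extendFrom (Metric.ball 0 1) (chiDisc t) ζ))) :=
      (analyticAt_coreMap_of_ne_one t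
        (ne_one_of_mem_chiRange ht (hmem ζ hζ))).continuousAt.tendsto.comp
        (tendsto_extendFrom (hlim ζ hζ))
    have h2 : Tendsto (fun w : ℂ => w) (𝓝[Metric.ball 0 1] ζ) (𝓝 ζ) := nhdsWithin_le_nhds
    refine tendsto_nhds_unique (h1.congr' ?_) h2
    filter_upwards [self_mem_nhdsWithin] with w hw
    exact coreMap_chiDisc ht (mem_ball_zero_iff.1 hw)

lemma isInverseMap_chi {t : ℝ} (ht : 0 < t) : IsInverseMap t (chi t) :=
  Classical.epsilon_spec (exists_isInverseMap ht)

namespace IsInverseMap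

variable {t : ℝ} {χ : ℂ → ℂ}

lemma coreMap_apply (h : IsInverseMap t χ) {ζ : ℂ} (hζ : ‖ζ‖ ≤ 1) : coreMap t (χ ζ) = ζ :=
  h.right_inv ζ (mem_closedBall_zero_iff.2 hζ)

/-- By connectedness `|χ|` would have to pass through `1` inside the disc, but `|w| = 1` forces
`|coreMap t w| = 1`. -/
lemma norm_lt_one (h : IsInverseMap t χ) {ζ : ℂ} (hζ : ‖ζ‖ < 1) : ‖χ ζ‖ < 1 := by
  by_contra hge
  have hc : ContinuousOn (fun ζ => ‖χ ζ‖) (Metric.ball 0 1) :=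
    (h.continuousOn.mono Metric.ball_subset_closedBall).norm
  obtain ⟨w, hw, hw1⟩ := (convex_ball (0 : ℂ) 1).isPreconnected.intermediate_value
    (Metric.mem_ball_self one_pos) (mem_ball_zero_iff.2 hζ) hc
    (⟨by simp [h.map_zero], not_lt.1 hge⟩ : (1 : ℝ) ∈ Set.Icc _ _)
  rw [mem_ball_zero_iff] at hw
  have h1 := norm_coreMap t (χ w)
  simp only at hw1
  rw [h.coreMap_apply hw.le, hw1] at h1
  simp at h1
  exact hw.ne h1

lemma norm_le_one (h : IsInverseMap t χ) {ζ : ℂ} (hζ : ‖ζ‖ ≤ 1) : ‖χ ζ‖ ≤ 1 := by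
  have hcl : closure (Metric.ball (0 : ℂ) 1) = Metric.closedBall 0 1 := closure_ball _ one_ne_zero
  have h1 : χ ζ ∈ closure (χ '' Metric.ball 0 1) :=
    (hcl ▸ h.continuousOn).image_closure ⟨ζ, hcl ▸ mem_closedBall_zero_iff.2 hζ, rfl⟩
  have h2 : χ '' Metric.ball 0 1 ⊆ Metric.closedBall 0 1 := by
    rintro _ ⟨w, hw, rfl⟩
    exact mem_closedBall_zero_iff.2 (h.norm_lt_one (mem_ball_zero_iff.1 hw)).le
  exact mem_closedBall_zero_iff.1 (closure_minimal h2 Metric.isClosed_closedBall h1)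

lemma eventuallyEq_coreInv (h : IsInverseMap t χ) : χ =ᶠ[𝓝 0] coreInv t := by
  have hc : Tendsto χ (𝓝 0) (𝓝 0) := by
    have := (h.continuousOn.continuousAt (Metric.closedBall_mem_nhds 0 one_pos)).tendsto
    rwa [h.map_zero] at this
  filter_upwards [hc.eventually (coreInv_coreMap t), Metric.closedBall_mem_nhds 0 one_pos]
    with ζ h1 h2
  rw [h.coreMap_apply (mem_closedBall_zero_iff.1 h2)] at h1
  exact h1.symm

end IsInverseMap

/-! ### Measures on the unit circle -/

section CircleMeasure

variable {μ ν : Measure ℂ}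

lemma ae_mem_sphere (hμ : μ (Metric.sphere 0 1)ᶜ = 0) : ∀ᵐ ω ∂μ, ω ∈ Metric.sphere (0 : ℂ) 1 := by
  rw [ae_iff]
  exact hμ

lemma ne_zero_of_mem_sphere {ω : ℂ} (h : ω ∈ Metric.sphere (0 : ℂ) 1) : ω ≠ 0 :=
  ne_zero_of_mem_unit_sphere (⟨ω, h⟩ : Metric.sphere (0 : ℂ) 1)

lemma continuousOn_zpow_sphere (k : ℤ) :
    ContinuousOn (fun ω : ℂ => ω ^ k) (Metric.sphere 0 1) := fun _ hω =>
  (continuousAt_zpow₀ _ k (Or.inl (ne_zero_of_mem_sphere hω))).continuousWithinAt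

lemma integrable_of_continuousOn_sphere [IsFiniteMeasure μ] (hμ : μ (Metric.sphere 0 1)ᶜ = 0)
    {F : ℂ → ℂ} (hF : ContinuousOn F (Metric.sphere 0 1)) : Integrable F μ := by
  have := hF.integrableOn_compact (μ := μ) (isCompact_sphere 0 1)
  rwa [IntegrableOn, Measure.restrict_eq_self_of_ae_mem (ae_mem_sphere hμ)] at this

lemma inv_eq_conj_of_mem_sphere {ω : ℂ} (h : ω ∈ Metric.sphere (0 : ℂ) 1) :
    ω⁻¹ = starRingEnd ℂ ω := by
  rw [mem_sphere_zero_iff_norm] at h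
  exact Complex.inv_eq_conj h

lemma add_pow_eq_sum_zpow (a b : ℂ) (n : ℕ) {ω : ℂ} (hω : ω ≠ 0) :
    (a * ω⁻¹ + b * ω) ^ n = ∑ m ∈ Finset.range (n + 1),
      (a ^ m * b ^ (n - m) * n.choose m) * ω ^ ((n : ℤ) - 2 * m) := by
  rw [add_pow]
  refine Finset.sum_congr rfl fun m hm => ?_
  have hm : m ≤ n := Nat.lt_succ_iff.1 (Finset.mem_range.1 hm)
  rw [mul_pow, mul_pow, show (n : ℤ) - 2 * m = -(m : ℤ) + ((n - m : ℕ) : ℤ) by omega,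
    zpow_add₀ hω, zpow_neg, zpow_natCast, zpow_natCast, inv_pow]
  ring

/-- The characteristic function of a probability measure on the circle in terms of its moments. -/
lemma charFun_eq_tsum_moments [IsProbabilityMeasure μ] (hμ : μ (Metric.sphere 0 1)ᶜ = 0) (x : ℂ) :
    charFun μ x = ∑' n : ℕ, ∑ m ∈ Finset.range (n + 1),
      ((n.factorial : ℂ)⁻¹ * ((Complex.I * x / 2) ^ m * (Complex.I * starRingEnd ℂ x / 2) ^ (n - m) *
        n.choose m)) * ∫ ω, ω ^ ((n : ℤ) - 2 * m) ∂μ := by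
  -- On the circle `i Re(x conj ω) = a ω⁻¹ + b ω`, so the exponential series consists of Laurent
  -- polynomials in `ω`.
  set a := Complex.I * x / 2
  set b := Complex.I * starRingEnd ℂ x / 2
  have hint : ∀ k : ℤ, Integrable (fun ω : ℂ => ω ^ k) μ := fun k =>
    integrable_of_continuousOn_sphere hμ (continuousOn_zpow_sphere k)
  set F : ℕ → ℂ → ℂ := fun n ω => ∑ m ∈ Finset.range (n + 1),
    ((n.factorial : ℂ)⁻¹ * (a ^ m * b ^ (n - m) * n.choose m)) * ω ^ ((n : ℤ) - 2 * m)
  have hF : ∀ ω ∈ Metric.sphere (0 : ℂ) 1, ∀ n, F n ω = (a * ω⁻¹ + b * ω) ^ n / n.factorial := by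
    intro ω hω n
    rw [add_pow_eq_sum_zpow _ _ _ (ne_zero_of_mem_sphere hω), Finset.sum_div]
    refine Finset.sum_congr rfl fun m _ => ?_
    rw [div_eq_inv_mul, mul_assoc]
  have hFint : ∀ n, Integrable (F n) μ := fun n =>
    integrable_finsetSum _ fun m _ => (hint _).const_mul _
  have hFb : ∀ n, ∀ᵐ ω ∂μ, ‖F n ω‖ ≤ (‖a‖ + ‖b‖) ^ n / n.factorial := by
    intro n
    filter_upwards [ae_mem_sphere hμ] with ω hω
    rw [hF ω hω, norm_div, norm_pow, Complex.norm_natCast]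
    rw [mem_sphere_zero_iff_norm] at hω
    gcongr
    refine (norm_add_le _ _).trans_eq ?_
    rw [norm_mul, norm_mul, norm_inv, hω, inv_one, mul_one, mul_one]
  have hsum : Summable fun n => ∫ ω, ‖F n ω‖ ∂μ := by
    refine Summable.of_nonneg_of_le (fun n => integral_nonneg fun _ => norm_nonneg _) (fun n => ?_)
      (Real.summable_pow_div_factorial (‖a‖ + ‖b‖))
    have := integral_mono_ae (hFint n).norm (integrable_const _) (hFb n)
    simpa using this
  have h1 := integral_tsum_of_summable_integral_norm hFint hsum
  have h2 : charFun μ x = ∫ ω, ∑' n, F n ω ∂μ := by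
    rw [charFun_apply]
    refine integral_congr_ae ?_
    filter_upwards [ae_mem_sphere hμ] with ω hω
    simp only [hF ω hω]
    have h3 := NormedSpace.expSeries_div_hasSum_exp (a * ω⁻¹ + b * ω)
    rw [← Complex.exp_eq_exp_ℂ] at h3
    rw [h3.tsum_eq]
    congr 1
    rw [inv_eq_conj_of_mem_sphere hω]
    simp only [a, b]
    rw [Complex.inner]
    apply Complex.ext <;> simp <;> ring
  rw [h2, ← h1]
  refine tsum_congr fun n => ?_
  rw [integral_finsetSum _ fun m _ => (hint _).const_mul _]
  exact Finset.sum_congr rfl fun m _ => integral_const_mul _ _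

/-- Probability measures on the unit circle are determined by their moments. -/
lemma ext_of_moments [IsProbabilityMeasure μ] [IsProbabilityMeasure ν]
    (hμ : μ (Metric.sphere 0 1)ᶜ = 0) (hν : ν (Metric.sphere 0 1)ᶜ = 0)
    (h : ∀ k : ℤ, ∫ ω, ω ^ k ∂μ = ∫ ω, ω ^ k ∂ν) : μ = ν := by
  refine Measure.ext_of_charFun (funext fun x => ?_)
  rw [charFun_eq_tsum_moments hμ, charFun_eq_tsum_moments hν]
  simp only [h]

end CircleMeasure

/-! ### Fourier coefficients of boundary values -/

lemma circleIntegrable_of_continuousOn {F : ℂ → ℂ} (hF : ContinuousOn F (Metric.sphere 0 1)) :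
    CircleIntegrable F 0 1 := hF.circleIntegrable zero_le_one

lemma circleAverage_zpow_neg_mul {F : ℂ → ℂ} (hF : DiffContOnCl ℂ F (Metric.ball 0 1)) (n : ℕ) :
    Real.circleAverage (fun ω => ω ^ (-(n : ℤ)) * F ω) 0 1 = taylorCoeff F n := by
  have h := hF.circleIntegral_one_div_sub_center_pow_smul one_pos n
  rw [Real.circleAverage_eq_circleIntegral one_ne_zero, taylorCoeff]
  have e : (fun z : ℂ => (z - 0)⁻¹ • (z ^ (-(n : ℤ)) * F z)) =
      fun z => (1 / (z - 0) ^ (n + 1)) • F z := by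
    ext z
    simp only [sub_zero, smul_eq_mul, zpow_neg, zpow_natCast, pow_succ, one_div, mul_inv]
    ring
  rw [e, h, smul_eq_mul, smul_eq_mul]
  have := Complex.two_pi_I_ne_zero
  field_simp

lemma circleAverage_pow_succ_mul {F : ℂ → ℂ} (hF : DiffContOnCl ℂ F (Metric.ball 0 1)) (n : ℕ) :
    Real.circleAverage (fun ω => ω ^ ((n + 1 : ℕ) : ℤ) * F ω) 0 1 = 0 := by
  have h : DiffContOnCl ℂ (fun ω => ω ^ (n + 1) * F ω) (Metric.ball 0 |1|) := by
    rw [abs_one]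
    exact (differentiable_fun_id.fun_pow (n + 1)).diffContOnCl.smul hF
  simp only [zpow_natCast]
  rw [h.circleAverage]
  simp

lemma circleAverage_zpow_mul_conj {F : ℂ → ℂ} (hF : ContinuousOn F (Metric.sphere 0 1)) (k : ℤ) :
    Real.circleAverage (fun ω => ω ^ k * starRingEnd ℂ (F ω)) 0 1 =
      starRingEnd ℂ (Real.circleAverage (fun ω => ω ^ (-k) * F ω) 0 1) := by
  have hc : CircleIntegrable (fun ω => ω ^ (-k) * F ω) 0 1 :=
    circleIntegrable_of_continuousOn ((continuousOn_zpow_sphere (-k)).mul hF)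
  have := (Complex.conjCLE.toContinuousLinearMap).circleAverage_comp_comm hc
  change _ = Complex.conjCLE.toContinuousLinearMap _
  rw [← this]
  apply Real.circleAverage_congr_sphere
  intro ω hω
  rw [abs_one] at hω
  simp only [Function.comp_apply, ContinuousLinearEquiv.coe_coe, Complex.conjCLE_apply, map_mul,
    map_zpow₀, ← inv_eq_conj_of_mem_sphere hω, inv_zpow', neg_neg]

/-- Fourier coefficients of `A + conj B` for holomorphic functions `A` and `B` that are continuous
on the closed disc. -/
lemma circleAverage_zpow_mul_add_conj {A B : ℂ → ℂ} (hA : DiffContOnCl ℂ A (Metric.ball 0 1))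
    (hB : DiffContOnCl ℂ B (Metric.ball 0 1)) (k : ℤ) :
    Real.circleAverage (fun ω => ω ^ k * (A ω + starRingEnd ℂ (B ω))) 0 1 =
      (if k ≤ 0 then taylorCoeff A k.natAbs else 0) +
        if 0 ≤ k then starRingEnd ℂ (taylorCoeff B k.natAbs) else 0 := by
  have hA' : ContinuousOn A (Metric.sphere 0 1) :=
    hA.continuousOn_ball.mono Metric.sphere_subset_closedBall
  have hB' : ContinuousOn B (Metric.sphere 0 1) :=
    hB.continuousOn_ball.mono Metric.sphere_subset_closedBall
  have key : ∀ {F : ℂ → ℂ}, DiffContOnCl ℂ F (Metric.ball 0 1) → ∀ k : ℤ,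
      Real.circleAverage (fun ω => ω ^ k * F ω) 0 1 =
        if k ≤ 0 then taylorCoeff F k.natAbs else 0 := by
    intro F hF k
    split_ifs with hk
    · rw [← circleAverage_zpow_neg_mul hF, show -(k.natAbs : ℤ) = k by omega]
    · have := circleAverage_pow_succ_mul hF (k.natAbs - 1)
      rwa [show ((k.natAbs - 1 + 1 : ℕ) : ℤ) = k by omega] at this
  have hiA : CircleIntegrable (fun ω => ω ^ k * A ω) 0 1 :=
    circleIntegrable_of_continuousOn ((continuousOn_zpow_sphere k).mul hA')
  have hiB : CircleIntegrable (fun ω => ω ^ k * starRingEnd ℂ (B ω)) 0 1 :=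
    circleIntegrable_of_continuousOn ((continuousOn_zpow_sphere k).mul
      (Complex.continuous_conj.comp_continuousOn hB'))
  simp only [mul_add]
  rw [Real.circleAverage_fun_add hiA hiB, circleAverage_zpow_mul_conj hB', key hA, key hB]
  congr 1
  by_cases hk : 0 ≤ k
  · rw [if_pos hk, if_pos (by omega), Int.natAbs_neg]
  · rw [if_neg hk, if_neg (by omega), map_zero]

/-! ### Measures with a continuous density on the circle -/

/-- The measure on the unit circle with density `ρ` with respect to the normalized arc length. -/
def circleDensity (ρ : ℂ → ℝ) : Measure ℂ :=
  ((volume.restrict (Set.Ioc 0 (2 * Real.pi))).withDensity fun θ =>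
    ENNReal.ofReal ((2 * Real.pi)⁻¹ * ρ (circleMap 0 1 θ))).map (circleMap 0 1)

section CircleDensity

variable {ρ : ℂ → ℝ}

lemma circleMap_mem_unit_sphere (θ : ℝ) : circleMap 0 1 θ ∈ Metric.sphere (0 : ℂ) 1 :=
  circleMap_mem_sphere 0 zero_le_one θ

lemma continuous_comp_circleMap {X : Type*} [TopologicalSpace X] {F : ℂ → X}
    (hF : ContinuousOn F (Metric.sphere 0 1)) :
    Continuous fun θ => F (circleMap 0 1 θ) :=
  hF.comp_continuous (continuous_circleMap 0 1) circleMap_mem_unit_sphere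

lemma circleDensity_compl_sphere (ρ : ℂ → ℝ) : circleDensity ρ (Metric.sphere 0 1)ᶜ = 0 := by
  rw [circleDensity, Measure.map_apply (continuous_circleMap 0 1).measurable
    Metric.isClosed_sphere.measurableSet.compl]
  have : circleMap 0 1 ⁻¹' (Metric.sphere (0 : ℂ) 1)ᶜ = ∅ := by
    ext θ
    simp
  rw [this, measure_empty]

lemma isFiniteMeasure_circleDensity (hρ : ContinuousOn ρ (Metric.sphere 0 1)) :
    IsFiniteMeasure (circleDensity ρ) := by
  have hc := continuous_comp_circleMap hρ
  have hi : Integrable (fun θ => (2 * Real.pi)⁻¹ * ρ (circleMap 0 1 θ))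
      (volume.restrict (Set.Ioc 0 (2 * Real.pi))) :=
    ((hc.const_mul _).integrableOn_Icc).mono_set Set.Ioc_subset_Icc_self
  have := isFiniteMeasure_withDensity_ofReal hi.2
  unfold circleDensity
  infer_instance

lemma integral_circleDensity (hρ : ContinuousOn ρ (Metric.sphere 0 1))
    (h0 : ∀ ω ∈ Metric.sphere (0 : ℂ) 1, 0 ≤ ρ ω) {F : ℂ → ℂ}
    (hF : ContinuousOn F (Metric.sphere 0 1)) :
    ∫ ω, F ω ∂(circleDensity ρ) = Real.circleAverage (fun ω => (ρ ω : ℂ) * F ω) 0 1 := by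
  have := isFiniteMeasure_circleDensity hρ
  have hFi := integrable_of_continuousOn_sphere (circleDensity_compl_sphere ρ) hF
  have hc := continuous_comp_circleMap hρ
  rw [circleDensity] at hFi ⊢
  rw [integral_map (continuous_circleMap 0 1).aemeasurable hFi.aestronglyMeasurable,
    integral_withDensity_eq_integral_toReal_smul (hc.measurable.const_mul _).ennreal_ofReal
      (Eventually.of_forall fun _ => ENNReal.ofReal_lt_top), Real.circleAverage_def,
    intervalIntegral.integral_of_le Real.two_pi_pos.le, ← integral_smul]
  refine integral_congr_ae (Eventually.of_forall fun θ => ?_)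
  have := h0 _ (circleMap_mem_unit_sphere θ)
  simp only
  rw [ENNReal.toReal_ofReal (by positivity), mul_smul]
  simp

end CircleDensity

/-! ### Symmetry under complex conjugation -/

lemma iteratedDeriv_conj_conj (f : ℂ → ℂ) (n : ℕ) (z : ℂ) :
    iteratedDeriv n (fun z => starRingEnd ℂ (f (starRingEnd ℂ z))) z =
      starRingEnd ℂ (iteratedDeriv n f (starRingEnd ℂ z)) := by
  induction n generalizing z with
  | zero => simp
  | succ n ih =>
    rw [iteratedDeriv_succ, iteratedDeriv_succ]
    have : iteratedDeriv n (fun z => starRingEnd ℂ (f (starRingEnd ℂ z))) =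
        starRingEnd ℂ ∘ iteratedDeriv n f ∘ starRingEnd ℂ := by
      ext z
      exact ih z
    rw [this, deriv_conj_conj]
    rfl

lemma taylorCoeff_conj_conj (f : ℂ → ℂ) (n : ℕ) :
    taylorCoeff (fun z => starRingEnd ℂ (f (starRingEnd ℂ z))) n =
      starRingEnd ℂ (taylorCoeff f n) := by
  rw [taylorCoeff, iteratedDeriv_conj_conj, taylorCoeff, map_zero, map_div₀, map_natCast]

lemma coreMap_conj (t : ℝ) (w : ℂ) :
    coreMap t (starRingEnd ℂ w) = starRingEnd ℂ (coreMap t w) := by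
  simp [coreMap, ← Complex.exp_conj, Complex.conj_ofNat]

lemma coreInv_conj (t : ℝ) :
    (fun z => starRingEnd ℂ (coreInv t (starRingEnd ℂ z))) =ᶠ[𝓝 0] coreInv t := by
  have hc : Tendsto (starRingEnd ℂ) (𝓝 0) (𝓝 0) := by
    simpa using Complex.continuous_conj.tendsto 0
  have h1 : Tendsto (fun z => starRingEnd ℂ (coreInv t (starRingEnd ℂ z))) (𝓝 0) (𝓝 0) :=
    hc.comp ((tendsto_coreInv t).comp hc)
  filter_upwards [hc.eventually (coreMap_coreInv t), h1.eventually (coreInv_coreMap t)]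
    with z h2 h3
  rw [coreMap_conj, h2, Complex.conj_conj] at h3
  exact h3.symm

/-- For real `t` the map `coreInv t` commutes with conjugation, so the conjugate moves onto `z`. -/
lemma conj_invCoeff_geomCore_zero (t : ℝ) (z : ℂ) (n : ℕ) :
    starRingEnd ℂ (invCoeff (geomCore 0 (starRingEnd ℂ z)) t n) = invCoeff (geomCore 0 z) t n := by
  rw [invCoeff, ← taylorCoeff_conj_conj, invCoeff]
  apply taylorCoeff_congr
  filter_upwards [coreInv_conj t] with w hw
  rw [← hw]
  simp [geomCore, coreMap_zero_left]

/-! ### The law of the free unitary Brownian motion -/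

namespace IsInverseMap

variable {t : ℝ} {χ : ℂ → ℂ}

lemma diffContOnCl_div (h : IsInverseMap t χ) {a b c d : ℂ}
    (hne : ∀ ζ ∈ Metric.closedBall (0 : ℂ) 1, c + d * χ ζ ≠ 0) :
    DiffContOnCl ℂ (fun ζ => (a + b * χ ζ) / (c + d * χ ζ)) (Metric.ball 0 1) := by
  refine ⟨?_, ?_⟩
  · exact ((h.differentiableOn.const_mul b).const_add a).fun_div
      ((h.differentiableOn.const_mul d).const_add c)
      fun ζ hζ => hne ζ (Metric.ball_subset_closedBall hζ)
  · rw [closure_ball _ one_ne_zero]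
    exact ContinuousOn.div (continuousOn_const.add (continuousOn_const.mul h.continuousOn))
      (continuousOn_const.add (continuousOn_const.mul h.continuousOn)) hne

lemma taylorCoeff_comp (h : IsInverseMap t χ) (H : ℂ → ℂ) (n : ℕ) :
    taylorCoeff (fun ζ => H (χ ζ)) n = invCoeff H t n := by
  apply taylorCoeff_congr
  filter_upwards [h.eventuallyEq_coreInv] with ζ hζ
  rw [hζ]

lemma one_sub_ne_zero (h : IsInverseMap t χ) {ζ : ℂ} (hζ : ζ ∈ Metric.closedBall (0 : ℂ) 1) :
    1 - χ ζ ≠ 0 := sub_ne_zero.2 (h.ne_one ζ hζ).symm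

lemma density_nonneg (h : IsInverseMap t χ) {ω : ℂ} (hω : ω ∈ Metric.sphere (0 : ℂ) 1) :
    0 ≤ ((1 + χ ω) / (1 - χ ω)).re := by
  rw [re_cayley]
  have := h.norm_le_one (mem_sphere_zero_iff_norm.1 hω).le
  have : 0 ≤ 1 - ‖χ ω‖ ^ 2 := by nlinarith [norm_nonneg (χ ω)]
  positivity

lemma diffContOnCl_cayley (h : IsInverseMap t χ) :
    DiffContOnCl ℂ (fun ζ => (1 + χ ζ) / (1 - χ ζ)) (Metric.ball 0 1) := by
  have := h.diffContOnCl_div (a := 1) (b := 1) (c := 1) (d := -1) fun ζ hζ => by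
    simpa [← sub_eq_add_neg] using h.one_sub_ne_zero hζ
  simpa [← sub_eq_add_neg] using this

lemma continuousOn_density (h : IsInverseMap t χ) :
    ContinuousOn (fun ω => ((1 + χ ω) / (1 - χ ω)).re) (Metric.sphere 0 1) :=
  Complex.continuous_re.comp_continuousOn
    (h.diffContOnCl_cayley.continuousOn_ball.mono Metric.sphere_subset_closedBall)

lemma taylorCoeff_cayley (h : IsInverseMap t χ) {n : ℕ} (hn : n ≠ 0) :
    taylorCoeff (fun ζ => (1 + χ ζ) / (1 - χ ζ)) n = 2 * invCoeff eta t n := by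
  have e : (fun ζ => (1 + χ ζ) / (1 - χ ζ)) =ᶠ[𝓝 0] fun ζ => 1 + 2 * eta (χ ζ) := by
    filter_upwards [Metric.closedBall_mem_nhds 0 one_pos] with ζ hζ
    have := h.one_sub_ne_zero hζ
    rw [eta]
    field_simp
    ring
  have ha : AnalyticAt ℂ (fun ζ => eta (χ ζ)) 0 :=
    (analyticAt_comp_coreInv analyticAt_eta t).congr
      (h.eventuallyEq_coreInv.fun_comp eta).symm
  rw [taylorCoeff_congr e, taylorCoeff_add analyticAt_const (analyticAt_const.fun_mul ha),
    taylorCoeff_const, if_neg hn, taylorCoeff_const_mul, h.taylorCoeff_comp, zero_add]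

/-- The law of the free unitary Brownian motion has the density `Re ((1 + χ) / (1 - χ))`. -/
lemma isFreeUnitaryLaw (h : IsInverseMap t χ) :
    IsFreeUnitaryLaw t (circleDensity fun ω => ((1 + χ ω) / (1 - χ ω)).re) := by
  set μ := circleDensity fun ω => ((1 + χ ω) / (1 - χ ω)).re
  have hfin : IsFiniteMeasure μ := isFiniteMeasure_circleDensity h.continuousOn_density
  have hmom : ∀ k : ℤ, ∫ ω, ω ^ k ∂μ = ((nu k t : ℝ) : ℂ) := by
    intro k
    rw [integral_circleDensity h.continuousOn_density (fun ω hω => h.density_nonneg hω)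
      (continuousOn_zpow_sphere k)]
    -- The real part is half of the Cayley transform plus its conjugate. For `k = 0` both halves
    -- contribute `1/2`; for `k ≠ 0` exactly one contributes, namely `ν_k`.
    have hd : DiffContOnCl ℂ (fun ζ => (2 : ℂ)⁻¹ * ((1 + χ ζ) / (1 - χ ζ))) (Metric.ball 0 1) :=
      h.diffContOnCl_cayley.const_smul (2 : ℂ)⁻¹
    have e : (fun ω : ℂ => ((((1 + χ ω) / (1 - χ ω)).re : ℝ) : ℂ) * ω ^ k) = fun ω =>
        ω ^ k * ((2 : ℂ)⁻¹ * ((1 + χ ω) / (1 - χ ω)) +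
          starRingEnd ℂ ((2 : ℂ)⁻¹ * ((1 + χ ω) / (1 - χ ω)))) := by
      ext ω
      rw [Complex.re_eq_add_conj, map_mul (starRingEnd ℂ) (2 : ℂ)⁻¹, map_inv₀, Complex.conj_ofNat]
      ring
    rw [e, circleAverage_zpow_mul_add_conj hd hd, taylorCoeff_const_mul]
    by_cases hk : k = 0
    · subst hk
      simp [taylorCoeff_zero, h.map_zero, nu, Complex.conj_ofNat]
      norm_num
    · rw [h.taylorCoeff_cayley (by omega), inv_mul_cancel_left₀ two_ne_zero,
        invCoeff_eta_eq_nu k hk, Complex.conj_ofReal]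
      rcases lt_or_gt_of_ne hk with hk | hk
      · rw [if_pos hk.le, if_neg (by omega), add_zero]
      · rw [if_neg (by omega), if_pos hk.le, zero_add]
  refine ⟨⟨?_⟩, circleDensity_compl_sphere _, hmom⟩
  have h1 := hmom 0
  simp only [zpow_zero, nu, if_pos, Complex.ofReal_one, integral_const, Complex.real_smul,
    mul_one] at h1
  have h2 : μ.real Set.univ = 1 := by exact_mod_cast h1
  rwa [measureReal_def, ENNReal.toReal_eq_one_iff] at h2

end IsInverseMap

lemma isFreeUnitaryLaw_freeUnitaryLaw {t : ℝ} (ht : 0 < t) :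
    IsFreeUnitaryLaw t (freeUnitaryLaw t) :=
  Classical.epsilon_spec ⟨_, (isInverseMap_chi ht).isFreeUnitaryLaw⟩

/-- The measure selected by `epsilon` is identified through uniqueness in the moment problem on the
circle. -/
lemma freeUnitaryLaw_eq {t : ℝ} (ht : 0 < t) :
    freeUnitaryLaw t = circleDensity fun ω => ((1 + chi t ω) / (1 - chi t ω)).re := by
  have h1 := isFreeUnitaryLaw_freeUnitaryLaw ht
  have h2 := (isInverseMap_chi ht).isFreeUnitaryLaw
  have := h1.prob
  have := h2.prob
  exact ext_of_moments h1.circle h2.circle fun k => (h1.moments k).trans (h2.moments k).symm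

/-! ### The free Hall transform -/

section FreeHall

variable {t : ℝ} {z : ℂ}

/-- The two exclusions in `domainSigma` serve separately: this one keeps `1/(1 - χ/z)` free of
poles, the reflected one `conj z χ/(1 - conj z χ)`. -/
lemma one_sub_inv_mul_chi_ne_zero (hz : z ∈ domainSigma t) {ζ : ℂ}
    (hζ : ζ ∈ Metric.closedBall (0 : ℂ) 1) : 1 - z⁻¹ * chi t ζ ≠ 0 := by
  intro h
  refine hz.2.1 ⟨ζ, hζ, ?_⟩
  have := hz.1
  field_simp at h
  linear_combination -h

lemma one_sub_conj_mul_chi_ne_zero (hz : z ∈ domainSigma t) {ζ : ℂ}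
    (hζ : ζ ∈ Metric.closedBall (0 : ℂ) 1) : 1 - starRingEnd ℂ z * chi t ζ ≠ 0 := by
  intro h
  refine hz.2.2 ⟨ζ, hζ, ?_⟩
  exact eq_inv_of_mul_eq_one_right (sub_eq_zero.1 h).symm

/-- The kernel of the free Hall transform with respect to the arc length. -/
lemma density_mul_kernel (ht : 0 < t) (hz : z ∈ domainSigma t) {ω : ℂ}
    (hω : ω ∈ Metric.sphere (0 : ℂ) 1) :
    ((((1 + chi t ω) / (1 - chi t ω)).re : ℝ) : ℂ) * (((‖1 - chi t ω‖ ^ 2 : ℝ) : ℂ) /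
      ((z - chi t ω) * (z⁻¹ - starRingEnd ℂ (chi t ω)))) =
      1 / (1 - z⁻¹ * chi t ω) +
        starRingEnd ℂ (starRingEnd ℂ z * chi t ω / (1 - starRingEnd ℂ z * chi t ω)) := by
  have hω' := Metric.sphere_subset_closedBall hω
  have h1 := (isInverseMap_chi ht).one_sub_ne_zero hω'
  have h2 := one_sub_inv_mul_chi_ne_zero hz hω'
  have h3 : 1 - z * starRingEnd ℂ (chi t ω) ≠ 0 := by
    have := (map_ne_zero (starRingEnd ℂ)).2 (one_sub_conj_mul_chi_ne_zero hz hω')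
    simpa using this
  have hz0 := hz.1
  set c := chi t ω
  have h4 : (((‖c‖ ^ 2 : ℝ)) : ℂ) = c * starRingEnd ℂ c := by
    rw [Complex.mul_conj, Complex.normSq_eq_norm_sq]
  have h5 : ((‖1 - c‖ ^ 2 : ℝ) : ℂ) ≠ 0 := by
    have := norm_ne_zero_iff.2 h1
    exact_mod_cast pow_ne_zero 2 this
  have h6 : z - c ≠ 0 := by
    intro h0
    apply h2
    rw [← sub_eq_zero.1 h0, inv_mul_cancel₀ hz0, sub_self]
  have h7 : z⁻¹ - starRingEnd ℂ c ≠ 0 := by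
    intro h0
    apply h3
    rw [← sub_eq_zero.1 h0, mul_inv_cancel₀ hz0, sub_self]
  -- The factor `|1 - c|²` of the kernel cancels the denominator of the density; what remains is a
  -- partial fraction identity for `(1 - c conj c)/((z - c)(z⁻¹ - conj c))`, valid modulo `z z⁻¹ =
  -- 1`.
  rw [re_cayley, Complex.ofReal_div, div_mul_div_comm, mul_comm (((1 - ‖c‖ ^ 2 : ℝ)) : ℂ),
    mul_div_mul_left _ _ h5, Complex.ofReal_sub, h4]
  simp only [map_div₀, map_sub, map_mul, map_one, Complex.conj_conj, Complex.ofReal_one]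
  rw [div_add_div _ _ h2 h3, div_eq_div_iff (mul_ne_zero h6 h7) (mul_ne_zero h2 h3)]
  linear_combination ((1 - c * starRingEnd ℂ c) * (c * starRingEnd ℂ c - 1) +
    c * starRingEnd ℂ c * (z * z⁻¹ - (z * starRingEnd ℂ c + c * z⁻¹) + c * starRingEnd ℂ c)) *
    (mul_inv_cancel₀ hz0)

lemma continuousOn_kernel (ht : 0 < t) (hz : z ∈ domainSigma t) :
    ContinuousOn (fun ω => (((‖1 - chi t ω‖ ^ 2 : ℝ) : ℂ) /
      ((z - chi t ω) * (z⁻¹ - starRingEnd ℂ (chi t ω))))) (Metric.sphere 0 1) := by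
  have hχ : ContinuousOn (chi t) (Metric.sphere 0 1) :=
    (isInverseMap_chi ht).continuousOn.mono Metric.sphere_subset_closedBall
  refine ContinuousOn.div ?_ ?_ ?_
  · exact Complex.continuous_ofReal.comp_continuousOn ((continuousOn_const.sub hχ).norm.pow 2)
  · exact (continuousOn_const.sub hχ).mul
      (continuousOn_const.sub (Complex.continuous_conj.comp_continuousOn hχ))
  · intro ω hω h0
    have hω' := Metric.sphere_subset_closedBall hω
    rcases mul_eq_zero.1 h0 with h | h
    · exact hz.2.1 ⟨ω, hω', (sub_eq_zero.1 h).symm⟩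
    · refine hz.2.2 ⟨ω, hω', ?_⟩
      rw [← map_inv₀, sub_eq_zero.1 h, Complex.conj_conj]

/-- In `A + conj B` a positive `k` selects a coefficient of `B`, a negative one a coefficient of
`A`; for `k = 0` the value is `A(0) = 1`, as `B(0) = 0`. -/
lemma freeHall_zpow (ht : 0 < t) (hz : z ∈ domainSigma t) (k : ℤ) :
    freeHall t (fun ω => ω ^ k) z = flowB (geomCore 0 z) (geomCore 0 z⁻¹) t k := by
  have hχ := isInverseMap_chi ht
  rw [freeHall, freeUnitaryLaw_eq ht, integral_circleDensity hχ.continuousOn_density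
    (fun ω hω => hχ.density_nonneg hω)
    ((continuousOn_zpow_sphere k).fun_mul (continuousOn_kernel ht hz))]
  have hA : DiffContOnCl ℂ (fun ζ => 1 / (1 - z⁻¹ * chi t ζ)) (Metric.ball 0 1) := by
    have := hχ.diffContOnCl_div (a := 1) (b := 0) (c := 1) (d := -z⁻¹) fun ζ hζ => by
      simpa [← sub_eq_add_neg] using one_sub_inv_mul_chi_ne_zero hz hζ
    simpa [← sub_eq_add_neg] using this
  have hB : DiffContOnCl ℂ (fun ζ => starRingEnd ℂ z * chi t ζ / (1 - starRingEnd ℂ z * chi t ζ))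
      (Metric.ball 0 1) := by
    have := hχ.diffContOnCl_div (a := 0) (b := starRingEnd ℂ z) (c := 1) (d := -starRingEnd ℂ z)
      fun ζ hζ => by
        simpa [← sub_eq_add_neg] using one_sub_conj_mul_chi_ne_zero hz hζ
    simpa [← sub_eq_add_neg] using this
  have e : Set.EqOn (fun ω : ℂ => ((((1 + chi t ω) / (1 - chi t ω)).re : ℝ) : ℂ) *
      (ω ^ k * (((‖1 - chi t ω‖ ^ 2 : ℝ) : ℂ) /
        ((z - chi t ω) * (z⁻¹ - starRingEnd ℂ (chi t ω))))))
      (fun ω => ω ^ k * (1 / (1 - z⁻¹ * chi t ω) +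
        starRingEnd ℂ (starRingEnd ℂ z * chi t ω / (1 - starRingEnd ℂ z * chi t ω))))
      (Metric.sphere 0 |1|) := by
    intro ω hω
    rw [abs_one] at hω
    simp only
    rw [← density_mul_kernel ht hz hω]
    ring
  rw [Real.circleAverage_congr_sphere e, circleAverage_zpow_mul_add_conj hA hB]
  have hBc : ∀ n, starRingEnd ℂ (taylorCoeff
      (fun ζ => starRingEnd ℂ z * chi t ζ / (1 - starRingEnd ℂ z * chi t ζ)) n) =
      invCoeff (geomCore 0 z) t n := by
    intro n
    rw [← conj_invCoeff_geomCore_zero, ← hχ.taylorCoeff_comp]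
    simp only [geomCore, coreMap_zero_left]
  have hAc : ∀ n ≠ 0, taylorCoeff (fun ζ => 1 / (1 - z⁻¹ * chi t ζ)) n =
      invCoeff (geomCore 0 z⁻¹) t n := by
    intro n hn
    have e : (fun ζ => 1 / (1 - z⁻¹ * chi t ζ)) =ᶠ[𝓝 0]
        fun ζ => 1 + geomCore 0 z⁻¹ (chi t ζ) := by
      filter_upwards [Metric.closedBall_mem_nhds 0 one_pos] with ζ hζ
      have := one_sub_inv_mul_chi_ne_zero hz hζ
      rw [geomCore, coreMap_zero_left, one_add_div this, sub_add_cancel]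
    have ha : AnalyticAt ℂ (fun ζ => geomCore 0 z⁻¹ (chi t ζ)) 0 :=
      (analyticAt_comp_coreInv (analyticAt_geomCore 0 z⁻¹) t).congr
        (hχ.eventuallyEq_coreInv.fun_comp (geomCore 0 z⁻¹)).symm
    rw [taylorCoeff_congr e, taylorCoeff_add analyticAt_const ha, taylorCoeff_const, if_neg hn,
      hχ.taylorCoeff_comp, zero_add]
  rw [hBc, flowB]
  rcases lt_trichotomy k 0 with hk | rfl | hk
  · rw [if_pos hk.le, if_neg (by omega), if_neg hk.ne, if_neg (by omega), hAc _ (by omega),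
      add_zero]
  · simp [taylorCoeff_zero, hχ.map_zero, invCoeff_index_zero, geomCore]
  · rw [if_neg (by omega), if_pos hk.le, if_neg hk.ne', if_pos hk, zero_add]

lemma freeHall_evalAt (ht : 0 < t) (hz : z ∈ domainSigma t) (f : ℂ[T;T⁻¹]) :
    freeHall t (evalAt f) z = evalLaurent (flowB (geomCore 0 z) (geomCore 0 z⁻¹) t) f := by
  have hlaw := isFreeUnitaryLaw_freeUnitaryLaw ht
  have := hlaw.prob
  have hint : ∀ k : ℤ, Integrable (fun ω => ω ^ k * (((‖1 - chi t ω‖ ^ 2 : ℝ) : ℂ) /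
      ((z - chi t ω) * (z⁻¹ - starRingEnd ℂ (chi t ω))))) (freeUnitaryLaw t) := fun k =>
    integrable_of_continuousOn_sphere hlaw.circle
      ((continuousOn_zpow_sphere k).mul (continuousOn_kernel ht hz))
  simp only [freeHall, evalAt, evalLaurent, Finsupp.sum, Finset.sum_mul, mul_assoc]
  rw [integral_finsetSum _ fun k _ => (hint k).const_mul _]
  refine Finset.sum_congr rfl fun k _ => ?_
  rw [integral_const_mul, ← freeHall_zpow ht hz, freeHall]

end FreeHall

end FreeSB

end

/-! ### The main theorem -/

theorem theorem1p15 (s t : ℝ) (hs : 0 < s) (ht : 0 < t) (hst : t / 2 < s) :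
    -- each `p_k`, `k ≥ 1`, is a polynomial in `u`
    (∀ k : ℕ, 1 ≤ k → ∃ p : Polynomial ℂ,
      FreeSB.transformH s t (LaurentPolynomial.T (k : ℤ)) = Polynomial.toLaurent p) ∧
    -- the series converges for all sufficiently small `u`, `z`
    (∃ r : ℝ, 0 < r ∧ ∀ u z : ℂ, ‖u‖ < r → ‖z‖ < r →
      Summable fun k : ℕ => FreeSB.genTerm s t u z (k + 1)) ∧
    -- the implicit formula, the series on the left converging
    (∃ r : ℝ, 0 < r ∧ r < 1 ∧ ∀ u z : ℂ, ‖u‖ < r → ‖z‖ < r →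
      1 - u * z * FreeSB.expCayley s z ≠ 0 ∧
      (Summable fun k : ℕ => FreeSB.genTerm s t u (z * FreeSB.expCayley (s - t) z) (k + 1)) ∧
      FreeSB.genFun s t u (z * FreeSB.expCayley (s - t) z) =
        (1 - u * z * FreeSB.expCayley s z)⁻¹ - 1) ∧
    -- the implicit formula determines the generating function near the origin
    (∀ F : ℂ → ℂ → ℂ,
      (∃ r : ℝ, 0 < r ∧ ∀ u z : ℂ, ‖u‖ < r → ‖z‖ < r →
        F u (z * FreeSB.expCayley (s - t) z) = (1 - u * z * FreeSB.expCayley s z)⁻¹ - 1) →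
      ∃ r : ℝ, 0 < r ∧ ∀ u z : ℂ, ‖u‖ < r → ‖z‖ < r → F u z = FreeSB.genFun s t u z) ∧
    -- for `s = t`, the transform `𝒢_{t,t}` is Biane's free Hall transform `𝒢^t`
    (s = t →
      FreeSB.IsInverseMap t (FreeSB.chi t) ∧
      FreeSB.IsFreeUnitaryLaw t (FreeSB.freeUnitaryLaw t) ∧
      ∀ f : LaurentPolynomial ℂ, ∀ z ∈ FreeSB.domainSigma t,
        FreeSB.freeHall t (FreeSB.evalAt f) z = FreeSB.evalAt (FreeSB.transformG t t f) z ∧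
        FreeSB.freeHall t (FreeSB.evalAt (FreeSB.transformH t t f)) z = FreeSB.evalAt f z) := by
  refine ⟨fun k _ => FreeSB.exists_toLaurent_eq fun m hm =>
      FreeSB.coeff_transformH_T_of_neg s t k hm, ?_, FreeSB.genFun_implicit s t,
    FreeSB.genFun_unique s t, fun _ => ⟨FreeSB.isInverseMap_chi ht,
      FreeSB.isFreeUnitaryLaw_freeUnitaryLaw ht, fun f z hz => ⟨?_, ?_⟩⟩⟩
  · obtain ⟨r, hr, -, h⟩ := FreeSB.exists_hasSum_genTerm s t
    exact ⟨r, hr, fun u z hu hz => (h u z hu hz).summable⟩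
  · rw [FreeSB.freeHall_evalAt ht hz, FreeSB.evalAt_transformG_self]
  · rw [FreeSB.freeHall_evalAt ht hz, ← FreeSB.evalAt_transformG_self,
      FreeSB.evalAt_transformG_transformH]
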